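/- Let $\mathcal A$ be a set of $d\ge 2$ letters, let $\pi_t,\pi_b:\mathcal A\to\{1,\dots,d\}$ be bijections and let $\lambda_\alpha>0$ $(\alpha\in\mathcal A)$. Put $\lambda^*=\sum_\alpha\lambda_\alpha$, $I=[0,\lambda^*)$, $p_\alpha=\sum_{\pi_t(\beta)<\pi_t(\alpha)}\lambda_\beta$, $q_\alpha=\sum_{\pi_b(\beta)<\pi_b(\alpha)}\lambda_\beta$, and let $T:I\to I$ be the interval exchange map $T(x)=x+q_\alpha-p_\alpha$ for $x\in I_\alpha=[p_\alpha,p_\alpha+\lambda_\alpha)$. Assume that $(\pi_t,\pi_b)$ is admissible, i.e. $\pi_t^{-1}(\{1,\dots,k\})\ne\pi_b^{-1}(\{1,\dots,k\})$ for $1\le k<d$, and that $T$ has the Keane property: there are no $\alpha,\beta\in\mathcal A$ and $m\ge1$ with $\pi_t(\beta)>1$ and $T^m(p_\alpha)=p_\beta$. *The algorithm.* Let $\alpha_t,\alpha_b$ be the letters with $\pi_t(\alpha_t)=\pi_b(\alpha_b)=d$. If $\lambda_{\alpha_t}>\lambda_{\alpha_b}$, the winner is $\alpha_t$, the loser is $\alpha_b$,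 and $\mathcal V(T)$ is the interval exchange map obtained by moving $\alpha_b$ in the bottom row to the place immediately after $\alpha_t$ and replacing $\lambda_{\alpha_t}$ by $\lambda_{\alpha_t}-\lambda_{\alpha_b}$. If $\lambda_{\alpha_b}>\lambda_{\alpha_t}$, the winner is $\alpha_b$, the loser is $\alpha_t$, and $\mathcal V(T)$ is obtained by moving $\alpha_t$ in the top row to the place immediately after $\alpha_b$ and replacing $\lambda_{\alpha_b}$ by $\lambda_{\alpha_b}-\lambda_{\alpha_t}$. (Under the assumptions, $T(n)=\mathcal V^n(T)$ is defined for all $n\ge0$.) Let $B_n=\mathbb I+E_{\beta\alpha}$, where $\alpha$ and $\beta$ are the winner and the loser of the step from $T(n-1)$ to $T(n)$ and $E_{\beta\alpha}$ is the matrix whose only nonzero entry is a $1$ at $(\beta,\alpha)$, and let $Q(m,n)=B_nB_{n-1}\cdots B_{m+1}$ for $m\le n$. Let $m_0=0$ and let $m_{k+1}>m_k$ be the largest integer such that not all letters are winners of steps from $T(j)$ to $T(j+1)$ with $m_k\le j<m_{k+1}$. Put $A(k,\ell)=Q(m_k,m_\ell)$, $A(k)=A(0,k)$, and $\|B\|=\sum_{\alpha,\beta}|B_{\alpha\beta}|$.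 *Condition (A).* For every $\varepsilon>0$ there is $C_\varepsilon>0$ such that $\|A(k,k+1)\|\le C_\varepsilon\|A(k)\|^{\varepsilon}$ for all $k\ge1$. *Condition (D).* For every $\varepsilon>0$ there is $C_\varepsilon>0$ such that $\Delta(T^n)\ge C_\varepsilon\, n^{-(1+\varepsilon)}$ for all $n\ge1$, where $\Delta(T^n)$ is the minimal distance between distinct points of $D(T^n)\cup\{0,\lambda^*\}$ and $D(T^n)$ is the set of discontinuity points of $T^n:I\to I$. **Theorem.** If $T$ satisfies Condition (A), then $T$ satisfies Condition (D). Moreover, Condition (D) also holds when $D(T^n)$ is taken to be the (possibly larger) set $\bigcup_{0\le i<n}T^{-i}(\{p_\alpha:\pi_t(\alpha)>1\})$. -/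

import Mathlib

/-- The data of an interval exchange map with `d` subintervals named by the letters of `𝒜`: the
positions `top` and `bot` of the subintervals before and after the exchange (`Fin d` is used for
positions, so positions are counted from `0`), and the lengths of the subintervals. -/
structure IntervalExchange (𝒜 : Type*) (d : ℕ) where
  top : 𝒜 ≃ Fin d
  bot : 𝒜 ≃ Fin d
  len : 𝒜 → ℝ

/-- The last letter of a row is moved to the place immediately after position `i`: positions up to
`i` are kept, the last position becomes `i + 1`, the other positions are shifted by one. -/
def moveLastFun {d : ℕ} (i j : Fin d) : Fin d :=
  if h : j ≤ i then j
  else if hd : (j : ℕ) + 1 = d then ⟨(i : ℕ) + 1, by omega⟩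
  else ⟨(j : ℕ) + 1, by omega⟩

theorem moveLastFun_injective {d : ℕ} (i : Fin d) : Function.Injective (moveLastFun i) := by
  intro a b h
  unfold moveLastFun at h
  split_ifs at h <;> simp only [Fin.ext_iff, Fin.le_def] at * <;> omega

/-- `moveLastFun i` as a permutation of the positions. -/
noncomputable def moveLast {d : ℕ} (i : Fin d) : Equiv.Perm (Fin d) :=
  Equiv.ofBijective (moveLastFun i)
    (Finite.injective_iff_bijective.mp (moveLastFun_injective i))

namespace IntervalExchange

section Basic

variable {𝒜 : Type*} [Fintype 𝒜] {d : ℕ}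

/-- The total length `λ^* = ∑ λ_α`. -/
noncomputable def total (T : IntervalExchange 𝒜 d) : ℝ := ∑ α, T.len α

/-- The interval `I = [0, λ^*)` on which the map acts. -/
def domain (T : IntervalExchange 𝒜 d) : Set ℝ := Set.Ico 0 T.total

/-- The left end `p_α` of the subinterval `I_α`. -/
noncomputable def p (T : IntervalExchange 𝒜 d) (α : 𝒜) : ℝ :=
  ∑ β with T.top β < T.top α, T.len β

/-- The left end `q_α` of the image of the subinterval `I_α`. -/
noncomputable def q (T : IntervalExchange 𝒜 d) (α : 𝒜) : ℝ :=
  ∑ β with T.bot β < T.bot α, T.len β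

/-- The subinterval `I_α = [p_α, p_α + λ_α)`. -/
def subinterval (T : IntervalExchange 𝒜 d) (α : 𝒜) : Set ℝ :=
  Set.Ico (T.p α) (T.p α + T.len α)

/-- The interval exchange map: `x ↦ x + q_α - p_α` on `I_α`. (Outside `I`, where the map is not
considered, this function is the identity.) -/
noncomputable def map (T : IntervalExchange 𝒜 d) (x : ℝ) : ℝ :=
  x + ∑ α, (T.subinterval α).indicator (fun _ => T.q α - T.p α) x

/-- Admissible combinatorial data: for `1 ≤ k < d`, the first `k` letters of the two rows do not
form the same set. -/
def Admissible (T : IntervalExchange 𝒜 d) : Prop :=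
  ∀ k : ℕ, 1 ≤ k → k < d → {α | (T.top α : ℕ) < k} ≠ {α | (T.bot α : ℕ) < k}

/-- The Keane property: there are no letters `α`, `β` and no `m ≥ 1` with `T^m (p_α) = p_β`, where
`β` is not the first letter of the top row. -/
def Keane (T : IntervalExchange 𝒜 d) : Prop :=
  ¬ ∃ α β : 𝒜, ∃ m : ℕ, 1 ≤ m ∧ 0 < (T.top β : ℕ) ∧ T.map^[m] (T.p α) = T.p β

/-- The discontinuity points of the iterate `T^n : I → I`. -/
def discontinuities (T : IntervalExchange 𝒜 d) (n : ℕ) : Set ℝ :=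
  {x ∈ T.domain | ¬ ContinuousWithinAt (T.map^[n]) T.domain x}

/-- The singularities `⋃_{i < n} T^{-i} {p_α : α not the first letter of the top row}` of `T^n`. -/
def singularities (T : IntervalExchange 𝒜 d) (n : ℕ) : Set ℝ :=
  {x ∈ T.domain | ∃ i < n, ∃ α : 𝒜, 0 < (T.top α : ℕ) ∧ T.map^[i] x = T.p α}

/-- The minimal distance between distinct points of `S ∪ {0, λ^*}`. -/
noncomputable def minDist (T : IntervalExchange 𝒜 d) (S : Set ℝ) : ℝ :=
  (S ∪ {0, T.total}).infsep

/-- Condition (D): the Roth type condition for the minimal distance between the discontinuity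
points of the iterates. -/
def ConditionD (T : IntervalExchange 𝒜 d) : Prop :=
  ∀ ε : ℝ, 0 < ε → ∃ C : ℝ, 0 < C ∧ ∀ n : ℕ, 1 ≤ n →
    C / (n : ℝ) ^ (1 + ε) ≤ T.minDist (T.discontinuities n)

/-- Condition (D), with every `p_α` (`α` not the first letter of the top row) treated as a
discontinuity of `T`, and every preimage `T^{-i} (p_α)`, `i < n`, as a discontinuity of `T^n`. -/
def SingularConditionD (T : IntervalExchange 𝒜 d) : Prop :=
  ∀ ε : ℝ, 0 < ε → ∃ C : ℝ, 0 < C ∧ ∀ n : ℕ, 1 ≤ n →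
    C / (n : ℝ) ^ (1 + ε) ≤ T.minDist (T.singularities n)

end Basic

section Rauzy

variable {𝒜 : Type*} [DecidableEq 𝒜] {d : ℕ} [NeZero d]

/-- The last letter `α_t` of the top row. -/
def lastTop (T : IntervalExchange 𝒜 d) : 𝒜 := T.top.symm ⊤

/-- The last letter `α_b` of the bottom row. -/
def lastBot (T : IntervalExchange 𝒜 d) : 𝒜 := T.bot.symm ⊤

/-- `T` is of top type. -/
def TopType (T : IntervalExchange 𝒜 d) : Prop := T.len T.lastBot < T.len T.lastTop

open Classical in
/-- The winner of the arrow associated with `T` in the Rauzy diagram. -/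
noncomputable def winner (T : IntervalExchange 𝒜 d) : 𝒜 :=
  if T.TopType then T.lastTop else T.lastBot

open Classical in
/-- The loser of the arrow associated with `T` in the Rauzy diagram. -/
noncomputable def loser (T : IntervalExchange 𝒜 d) : 𝒜 :=
  if T.TopType then T.lastBot else T.lastTop

open Classical in
/-- One step `𝒱` of the Rauzy–Veech algorithm. For the top type, the last letter of the bottom row
is moved to the place after `α_t` in that row; for the bottom type, the last letter of the top row
is moved to the place after `α_b` in that row. The length of the loser is subtracted from the length
of the winner. (Equal lengths of `α_t` and `α_b` do not occur for admissible maps with the Keane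
property.) -/
noncomputable def rauzyStep (T : IntervalExchange 𝒜 d) : IntervalExchange 𝒜 d where
  top := if T.TopType then T.top else T.top.trans (moveLast (T.top T.lastBot))
  bot := if T.TopType then T.bot.trans (moveLast (T.bot T.lastTop)) else T.bot
  len := Function.update T.len T.winner (T.len T.winner - T.len T.loser)

/-- `T(n) = 𝒱^n (T)`. -/
noncomputable def renorm (T : IntervalExchange 𝒜 d) (n : ℕ) : IntervalExchange 𝒜 d :=
  rauzyStep^[n] T

/-- The matrix `𝕀 + E_{βα}` of the arrow with winner `α` and loser `β` associated with `T`. -/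
noncomputable def arrowMatrix (T : IntervalExchange 𝒜 d) : Matrix 𝒜 𝒜 ℤ :=
  1 + Matrix.single T.loser T.winner 1

/-- The times `m_k` of the Marmi–Moussa–Yoccoz acceleration: `m_0 = 0`, and `m_{k+1} > m_k` is the largest
integer such that some letter is not the winner of any of the arrows number `m_k, …, m_{k+1} - 1`
of the Rauzy path of `T`. -/
noncomputable def mmyTime (T : IntervalExchange 𝒜 d) : ℕ → ℕ
  | 0 => 0
  | k + 1 => sSup {m : ℕ | mmyTime T k < m ∧
      ∃ α : 𝒜, ∀ j : ℕ, mmyTime T k ≤ j → j < m → (T.renorm j).winner ≠ α}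

variable [Fintype 𝒜]

/-- The matrix `Q(m, n) = B_{γ_n} ⋯ B_{γ_{m+1}}` of the part of the Rauzy path of `T` from `T(m)`
to `T(n)`, for `m ≤ n`. -/
noncomputable def cocycle (T : IntervalExchange 𝒜 d) (m : ℕ) : ℕ → Matrix 𝒜 𝒜 ℤ
  | 0 => 1
  | n + 1 => if m ≤ n then (T.renorm n).arrowMatrix * cocycle T m n else 1

/-- The Marmi–Moussa–Yoccoz cocycle `A(k, ℓ) = Q(m_k, m_ℓ)`. -/
noncomputable def mmyCocycle (T : IntervalExchange 𝒜 d) (k l : ℕ) : Matrix 𝒜 𝒜 ℤ :=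
  T.cocycle (T.mmyTime k) (T.mmyTime l)

/-- The norm of a matrix: the sum of the absolute values of its entries. -/
noncomputable def entryNorm (B : Matrix 𝒜 𝒜 ℤ) : ℝ := ∑ α, ∑ β, |(B α β : ℝ)|

/-- Condition (A): the Roth type growth condition for the Marmi–Moussa–Yoccoz cocycle
(with `A(k) = A(0, k)`). -/
def ConditionA (T : IntervalExchange 𝒜 d) : Prop :=
  ∀ ε : ℝ, 0 < ε → ∃ C : ℝ, 0 < C ∧ ∀ k : ℕ, 1 ≤ k →
    entryNorm (T.mmyCocycle k (k + 1)) ≤ C * entryNorm (T.mmyCocycle 0 k) ^ ε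

end Rauzy

end IntervalExchange

set_option linter.unusedSectionVars false

/-! Everything is read off the Rokhlin towers over the renormalized maps T(m) (`IsTower`): T(m) is a
first return map of T, the tower heights are the row sums of Q(0,m), and the floors are translated
copies of the subintervals of T(m), each inside one subinterval of T.

The combinatorial input is `mmyCocycle_pos`: 4d consecutive blocks of the acceleration have a
product with all entries positive. It rests on `frequently_winner` (admissibility and the Keane
property force every letter to win infinitely often) and on `loser_rauzyStep`, by which the support
of a column must grow. Consequently, 4d blocks later, every height is at least the old norm of the
cocycle (`entryNorm_le_returnTime`), and the whole domain is no longer than any old subinterval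
(`total_le_len`).

Given n, let k be least with ‖A(k)‖ ≥ n. At level k+4d all heights are at least n. At level k+8d the
whole domain fits into the first subinterval of level k+4d, and then every singularity of T^n is a
left end of a floor at level k+8d (`singularities_subset_towerEnds`): otherwise the orbit of 0 would
meet some p_β, against the Keane property. Such left ends are separated by the shortest subinterval
of that level (`le_minDist_of_subset_towerEnds`), which is at least the total length at level k+12d,
hence at least λ^*/‖A(k+12d)‖. Condition (A), iterated 12d+1 times from level k-1, where the norm is
below n, bounds ‖A(k+12d)‖ by C n^(1+ε) (`ConditionA.entryNorm_add_le`). The case k = 0 only affects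
the constant. -/

namespace IntervalExchange

/-! ### Left ends of the intervals of a row -/

section RowStart

variable {𝒜 : Type*} [Fintype 𝒜] {d : ℕ}

/-- The total length of the intervals before the letter `α` in the row `e`. -/
noncomputable def rowStart (e : 𝒜 ≃ Fin d) (len : 𝒜 → ℝ) (α : 𝒜) : ℝ :=
  ∑ β with e β < e α, len β

theorem rowStart_nonneg (e : 𝒜 ≃ Fin d) {len : 𝒜 → ℝ} (h : ∀ α, 0 < len α) (α : 𝒜) :
    0 ≤ rowStart e len α :=
  Finset.sum_nonneg fun β _ => (h β).le

theorem rowStart_add_len (e : 𝒜 ≃ Fin d) (len : 𝒜 → ℝ) (α : 𝒜) :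
    rowStart e len α + len α = ∑ β with e β ≤ e α, len β := by
  classical
  have : (Finset.univ.filter fun β => e β ≤ e α) =
      insert α (Finset.univ.filter fun β => e β < e α) := by
    ext β
    simp only [Finset.mem_filter, Finset.mem_univ, true_and, Finset.mem_insert]
    rw [le_iff_eq_or_lt, e.apply_eq_iff_eq]
  rw [this, Finset.sum_insert (by simp), add_comm, rowStart]

theorem rowStart_add_len_le (e : 𝒜 ≃ Fin d) {len : 𝒜 → ℝ} (h : ∀ α, 0 < len α) {α β : 𝒜}
    (hαβ : e α < e β) : rowStart e len α + len α ≤ rowStart e len β := by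
  rw [rowStart_add_len]
  refine Finset.sum_le_sum_of_subset_of_nonneg ?_ fun γ _ _ => (h γ).le
  intro γ hγ
  simp only [Finset.mem_filter, Finset.mem_univ, true_and] at hγ ⊢
  exact hγ.trans_lt hαβ

theorem rowStart_add_len_le_sum (e : 𝒜 ≃ Fin d) {len : 𝒜 → ℝ} (h : ∀ α, 0 < len α) (α : 𝒜) :
    rowStart e len α + len α ≤ ∑ β, len β := by
  rw [rowStart_add_len]
  exact Finset.sum_le_sum_of_subset_of_nonneg (Finset.subset_univ _) fun γ _ _ => (h γ).le

theorem rowStart_add_len_last (e : 𝒜 ≃ Fin d) (len : 𝒜 → ℝ) {α : 𝒜} (hα : ∀ β, e β ≤ e α) :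
    rowStart e len α + len α = ∑ β, len β := by
  rw [rowStart_add_len]
  exact Finset.sum_congr (by simp [hα]) fun _ _ => rfl

theorem rowStart_first (e : 𝒜 ≃ Fin d) (len : 𝒜 → ℝ) {α : 𝒜} (hα : (e α : ℕ) = 0) :
    rowStart e len α = 0 := by
  refine Finset.sum_eq_zero fun β hβ => ?_
  simp only [Finset.mem_filter, Finset.mem_univ, true_and, Fin.lt_def] at hβ
  omega

theorem eq_of_mem_row (e : 𝒜 ≃ Fin d) {len : 𝒜 → ℝ} (h : ∀ α, 0 < len α) {α β : 𝒜} {x : ℝ}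
    (hα : x ∈ Set.Ico (rowStart e len α) (rowStart e len α + len α))
    (hβ : x ∈ Set.Ico (rowStart e len β) (rowStart e len β + len β)) : α = β := by
  rcases lt_trichotomy (e α) (e β) with hlt | heq | hlt
  · have := rowStart_add_len_le e h hlt
    linarith [hα.2, hβ.1]
  · exact e.injective heq
  · have := rowStart_add_len_le e h hlt
    linarith [hβ.2, hα.1]

theorem exists_mem_row (e : 𝒜 ≃ Fin d) {len : 𝒜 → ℝ} {x : ℝ}
    (h0 : 0 ≤ x) (hx : x < ∑ β, len β) :
    ∃ α, x ∈ Set.Ico (rowStart e len α) (rowStart e len α + len α) := by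
  classical
  have hne : Nonempty 𝒜 := by
    by_contra hc
    rw [not_nonempty_iff] at hc
    simp at hx
    linarith
  have hd : 0 < d := by
    have := Fintype.card_congr e
    rw [Fintype.card_fin] at this
    rw [← this]
    exact Fintype.card_pos
  -- Take the rightmost letter whose left end is at most x; its right end is the next left end, or
  -- the end of the row.
  obtain ⟨α, hα, hmax⟩ := Finset.exists_max_image
    (Finset.univ.filter fun α => rowStart e len α ≤ x) e
    ⟨e.symm ⟨0, hd⟩, by simpa [rowStart_first e len (α := e.symm ⟨0, hd⟩) (by simp)] using h0⟩
  simp only [Finset.mem_filter, Finset.mem_univ, true_and] at hα hmax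
  refine ⟨α, hα, ?_⟩
  by_cases hlast : (e α : ℕ) + 1 = d
  · rw [rowStart_add_len_last]
    · exact hx
    · intro β
      rw [Fin.le_def]
      omega
  · set β := e.symm ⟨(e α : ℕ) + 1, by omega⟩ with hβ
    have hβ' : (e β : ℕ) = e α + 1 := by simp [hβ]
    have hlt : rowStart e len α + len α = rowStart e len β := by
      rw [rowStart_add_len]
      refine Finset.sum_congr ?_ fun _ _ => rfl
      ext γ
      simp only [Finset.mem_filter, Finset.mem_univ, true_and, Fin.le_def, Fin.lt_def]
      omega
    rw [hlt]
    by_contra hc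
    have := hmax β (not_lt.mp hc)
    rw [Fin.le_def] at this
    omega

theorem rowStart_eq_sum_ite (e : 𝒜 ≃ Fin d) (len : 𝒜 → ℝ) (α : 𝒜) :
    rowStart e len α = ∑ β, if e β < e α then len β else 0 := by
  rw [rowStart, Finset.sum_filter]

end RowStart

/-! ### Moving the last letter of a row -/

section MoveLast

variable {d : ℕ}

theorem moveLast_of_le {i j : Fin d} (h : j ≤ i) : moveLast i j = j := by
  simp [moveLast, moveLastFun, h]

theorem moveLast_of_lt {i j : Fin d} (h : i < j) (hd : (j : ℕ) + 1 ≠ d) :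
    (moveLast i j : ℕ) = j + 1 := by
  simp [moveLast, moveLastFun, not_le.mpr h, hd]

theorem moveLast_last {i j : Fin d} (h : i < j) (hd : (j : ℕ) + 1 = d) :
    (moveLast i j : ℕ) = i + 1 := by
  simp [moveLast, moveLastFun, not_le.mpr h, hd]

theorem le_moveLast {i j : Fin d} (hd : (j : ℕ) + 1 ≠ d) : j ≤ moveLast i j := by
  rcases le_or_gt j i with h | h
  · rw [moveLast_of_le h]
  · rw [Fin.le_def, moveLast_of_lt h hd]
    omega

theorem moveLast_lt_iff {i j j' : Fin d} (hj : (j : ℕ) + 1 ≠ d) (hj' : (j' : ℕ) + 1 ≠ d) :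
    moveLast i j < moveLast i j' ↔ j < j' := by
  rcases le_or_gt j i with h | h <;> rcases le_or_gt j' i with h' | h'
  · rw [moveLast_of_le h, moveLast_of_le h']
  · rw [moveLast_of_le h, Fin.lt_def, moveLast_of_lt h' hj', Fin.lt_def]
    rw [Fin.le_def] at h
    rw [Fin.lt_def] at h'
    omega
  · rw [moveLast_of_le h', Fin.lt_def, moveLast_of_lt h hj, Fin.lt_def]
    rw [Fin.le_def] at h'
    rw [Fin.lt_def] at h
    omega
  · rw [Fin.lt_def, moveLast_of_lt h hj, moveLast_of_lt h' hj', Fin.lt_def]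
    omega

theorem moveLast_last_lt_iff {i j j' : Fin d} (hij : i < j) (hj : (j : ℕ) + 1 = d)
    (hj' : (j' : ℕ) + 1 ≠ d) : moveLast i j < moveLast i j' ↔ i < j' := by
  rw [Fin.lt_def, moveLast_last hij hj]
  rcases le_or_gt j' i with h' | h'
  · rw [moveLast_of_le h']
    rw [Fin.le_def] at h'
    rw [Fin.lt_def]
    omega
  · rw [moveLast_of_lt h' hj']
    rw [Fin.lt_def] at h' ⊢
    omega

theorem moveLast_lt_last_iff {i j j' : Fin d} (hij : i < j) (hj : (j : ℕ) + 1 = d)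
    (hj' : (j' : ℕ) + 1 ≠ d) : moveLast i j' < moveLast i j ↔ j' ≤ i := by
  rw [Fin.lt_def, moveLast_last hij hj]
  rcases le_or_gt j' i with h' | h'
  · rw [moveLast_of_le h']
    rw [Fin.le_def] at h' ⊢
    omega
  · rw [moveLast_of_lt h' hj']
    rw [Fin.lt_def] at h'
    rw [Fin.le_def]
    omega

variable {𝒜 : Type*}

/-- As `w` is last in the other row, it is not among the first k letters; so the insertion after `w`
happens beyond the first k places. This is how admissibility survives a Rauzy step. -/
theorem setOf_moveLast_lt (e f : 𝒜 ≃ Fin d) {w : 𝒜} (hw : (f w : ℕ) + 1 = d) {k : ℕ} (hk : k < d)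
    (h : {α | (f α : ℕ) < k} = {α | ((e.trans (moveLast (e w))) α : ℕ) < k}) :
    {α | (f α : ℕ) < k} = {α | (e α : ℕ) < k} := by
  have hkw : k ≤ e w := by
    by_contra hc
    have : w ∈ {α | (f α : ℕ) < k} := by
      rw [h]
      simpa [moveLast_of_le (le_refl (e w))] using hc
    simp only [Set.mem_ofPred_eq] at this
    omega
  rw [h]
  ext α
  simp only [Set.mem_ofPred_eq, Equiv.trans_apply]
  rcases le_or_gt (e α) (e w) with hle | hlt
  · rw [moveLast_of_le hle]
  · by_cases hd : (e α : ℕ) + 1 = d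
    · rw [moveLast_last hlt hd]
      rw [Fin.lt_def] at hlt
      omega
    · rw [moveLast_of_lt hlt hd]
      rw [Fin.lt_def] at hlt
      omega

variable [Fintype 𝒜] [DecidableEq 𝒜]

/-- The left ends in the row of the winner do not change. -/
theorem rowStart_update (e : 𝒜 ≃ Fin d) (len : 𝒜 → ℝ) {w : 𝒜} (hw : (e w : ℕ) + 1 = d) (c : ℝ)
    (α : 𝒜) : rowStart e (Function.update len w c) α = rowStart e len α := by
  refine Finset.sum_congr rfl fun β hβ => ?_
  simp only [Finset.mem_filter, Finset.mem_univ, true_and, Fin.lt_def] at hβ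
  rw [Function.update_of_ne]
  rintro rfl
  omega

/-- Only the terms of `w` and `l` change: `w` loses `len l`, and `l` is inserted directly behind it,
so together they occupy the old place of `w`. -/
theorem rowStart_moveLast (e : 𝒜 ≃ Fin d) (len : 𝒜 → ℝ) {w l : 𝒜} (hwl : w ≠ l)
    (hl : (e l : ℕ) + 1 = d) {α : 𝒜} (hα : α ≠ l) :
    rowStart (e.trans (moveLast (e w))) (Function.update len w (len w - len l)) α =
      rowStart e len α := by
  have hlast : ∀ β, β ≠ l → (e β : ℕ) + 1 ≠ d := fun β hβ h =>
    hβ (e.injective (Fin.ext (by omega)))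
  have hlw : e w < e l := by
    have := hlast w hwl
    rw [Fin.lt_def]
    omega
  have hlα : ¬ e l < e α := by
    rw [Fin.lt_def]
    omega
  rw [rowStart_eq_sum_ite, rowStart_eq_sum_ite, ← sub_eq_zero, ← Finset.sum_sub_distrib,
    ← Finset.sum_subset (Finset.subset_univ {w, l}), Finset.sum_pair hwl]
  · simp only [Equiv.trans_apply, Function.update_self, Function.update_of_ne hwl.symm,
      moveLast_lt_iff (hlast w hwl) (hlast α hα), moveLast_last_lt_iff hlw hl (hlast α hα)]
    split_ifs <;> ring
  · intro β _ hβ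
    simp only [Finset.mem_insert, Finset.mem_singleton, not_or] at hβ
    simp only [Equiv.trans_apply, Function.update_of_ne hβ.1,
      moveLast_lt_iff (hlast β hβ.2) (hlast α hα), sub_self]

theorem rowStart_moveLast_self (e : 𝒜 ≃ Fin d) (len : 𝒜 → ℝ) {w l : 𝒜} (hwl : w ≠ l)
    (hl : (e l : ℕ) + 1 = d) :
    rowStart (e.trans (moveLast (e w))) (Function.update len w (len w - len l)) l =
      rowStart e len w + len w - len l := by
  have hlast : ∀ β, β ≠ l → (e β : ℕ) + 1 ≠ d := fun β hβ h =>
    hβ (e.injective (Fin.ext (by omega)))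
  have hlw : e w < e l := by
    have := hlast w hwl
    rw [Fin.lt_def]
    omega
  rw [rowStart_add_len, Finset.sum_filter, rowStart_eq_sum_ite, ← sub_eq_zero, sub_sub_eq_add_sub,
    add_sub_right_comm, ← Finset.sum_sub_distrib,
    ← Finset.sum_subset (Finset.subset_univ {w, l}), Finset.sum_pair hwl]
  · simp only [Equiv.trans_apply, Function.update_self,
      moveLast_lt_last_iff hlw hl (hlast w hwl), le_refl, if_true, lt_irrefl, if_false,
      not_le.mpr hlw]
    ring
  · intro β _ hβ
    simp only [Finset.mem_insert, Finset.mem_singleton, not_or] at hβ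
    simp only [Equiv.trans_apply, Function.update_of_ne hβ.1,
      moveLast_lt_last_iff hlw hl (hlast β hβ.2), sub_self]

end MoveLast

/-! ### The map on the subintervals -/

section Map

variable {𝒜 : Type*} [Fintype 𝒜] {d : ℕ} {T : IntervalExchange 𝒜 d}

theorem map_eq (hlen : ∀ α, 0 < T.len α) {α : 𝒜} {x : ℝ} (hx : x ∈ T.subinterval α) :
    T.map x = x + (T.q α - T.p α) := by
  rw [map, Finset.sum_eq_single α, Set.indicator_of_mem hx]
  · intro β _ hβ
    rw [Set.indicator_of_notMem]
    exact fun h => hβ (eq_of_mem_row T.top hlen h hx)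
  · simp

theorem subinterval_subset_domain (hlen : ∀ α, 0 < T.len α) (α : 𝒜) :
    T.subinterval α ⊆ T.domain := fun _ hx =>
  ⟨(rowStart_nonneg T.top hlen α).trans hx.1,
    hx.2.trans_le (rowStart_add_len_le_sum T.top hlen α)⟩

theorem exists_mem_subinterval {x : ℝ} (hx : x ∈ T.domain) : ∃ α, x ∈ T.subinterval α :=
  exists_mem_row T.top hx.1 hx.2

theorem p_mem_subinterval (hlen : ∀ α, 0 < T.len α) (α : 𝒜) : T.p α ∈ T.subinterval α :=
  ⟨le_rfl, by linarith [hlen α]⟩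

theorem p_mem_domain (hlen : ∀ α, 0 < T.len α) (α : 𝒜) : T.p α ∈ T.domain :=
  subinterval_subset_domain hlen α (p_mem_subinterval hlen α)

theorem p_injective (hlen : ∀ α, 0 < T.len α) : Function.Injective T.p := fun α β h =>
  eq_of_mem_row T.top hlen (p_mem_subinterval hlen α) (h ▸ p_mem_subinterval hlen β)

theorem map_mem (hlen : ∀ α, 0 < T.len α) {α : 𝒜} {x : ℝ} (hx : x ∈ T.subinterval α) :
    T.map x ∈ Set.Ico (T.q α) (T.q α + T.len α) := by
  rw [map_eq hlen hx]
  exact ⟨by linarith [hx.1], by linarith [hx.2]⟩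

theorem mapsTo_map (hlen : ∀ α, 0 < T.len α) : Set.MapsTo T.map T.domain T.domain := by
  intro x hx
  obtain ⟨α, hα⟩ := exists_mem_subinterval hx
  have h := map_mem hlen hα
  exact ⟨(rowStart_nonneg T.bot hlen α).trans h.1,
    h.2.trans_le (rowStart_add_len_le_sum T.bot hlen α)⟩

theorem injOn_map (hlen : ∀ α, 0 < T.len α) : Set.InjOn T.map T.domain := by
  intro x hx y hy h
  obtain ⟨α, hα⟩ := exists_mem_subinterval hx
  obtain ⟨β, hβ⟩ := exists_mem_subinterval hy
  obtain rfl : α = β :=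
    eq_of_mem_row T.bot hlen (map_mem hlen hα) (h ▸ map_mem hlen hβ)
  rw [map_eq hlen hα, map_eq hlen hβ] at h
  linarith

theorem total_pos [NeZero d] (hlen : ∀ α, 0 < T.len α) : 0 < T.total :=
  Finset.sum_pos (fun α _ => hlen α) ⟨T.top.symm ⊤, Finset.mem_univ _⟩

end Map

/-! ### One step of the Rauzy–Veech algorithm -/

section Step

variable {𝒜 : Type*} [Fintype 𝒜] [DecidableEq 𝒜] {d : ℕ} [NeZero d]

/-- The standing assumptions: positive lengths, admissible combinatorial data, Keane property. -/
structure Regular (T : IntervalExchange 𝒜 d) : Prop where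
  len_pos : ∀ α, 0 < T.len α
  admissible : T.Admissible
  keane : T.Keane

theorem top_lastTop (T : IntervalExchange 𝒜 d) : (T.top T.lastTop : ℕ) + 1 = d := by
  have := NeZero.pos d
  simp only [lastTop, Equiv.apply_symm_apply, Fin.val_top]
  omega

theorem bot_lastBot (T : IntervalExchange 𝒜 d) : (T.bot T.lastBot : ℕ) + 1 = d := by
  have := NeZero.pos d
  simp only [lastBot, Equiv.apply_symm_apply, Fin.val_top]
  omega

theorem eq_lastTop {T : IntervalExchange 𝒜 d} {α : 𝒜} (h : (T.top α : ℕ) + 1 = d) :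
    α = T.lastTop :=
  T.top.injective (Fin.ext (by have := T.top_lastTop; omega))

theorem eq_lastBot {T : IntervalExchange 𝒜 d} {α : 𝒜} (h : (T.bot α : ℕ) + 1 = d) :
    α = T.lastBot :=
  T.bot.injective (Fin.ext (by have := T.bot_lastBot; omega))

theorem p_lastTop (T : IntervalExchange 𝒜 d) : T.p T.lastTop + T.len T.lastTop = T.total :=
  rowStart_add_len_last T.top T.len fun β => by
    have := T.top_lastTop
    rw [Fin.le_def]
    omega

theorem q_lastBot (T : IntervalExchange 𝒜 d) : T.q T.lastBot + T.len T.lastBot = T.total :=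
  rowStart_add_len_last T.bot T.len fun β => by
    have := T.bot_lastBot
    rw [Fin.le_def]
    omega

variable {T : IntervalExchange 𝒜 d}

theorem Admissible.lastTop_ne_lastBot (hd : 2 ≤ d) (h : T.Admissible) :
    T.lastTop ≠ T.lastBot := by
  intro heq
  refine h (d - 1) (by omega) (by omega) ?_
  ext α
  have h1 := T.top_lastTop
  have h2 := T.bot_lastBot
  have h3 : (T.top α : ℕ) + 1 = d ↔ (T.bot α : ℕ) + 1 = d :=
    ⟨fun h => by rw [eq_lastTop h, heq]; exact h2, fun h => by rw [eq_lastBot h, ← heq]; exact h1⟩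
  simp only [Set.mem_ofPred_eq]
  omega

/-- Equal lengths would make T send the left end of `lastBot` to that of `lastTop`, a connection
excluded by the Keane property. -/
theorem Regular.len_lastTop_ne (hd : 2 ≤ d) (h : T.Regular) :
    T.len T.lastTop ≠ T.len T.lastBot := by
  intro heq
  refine h.keane ⟨T.lastBot, T.lastTop, 1, le_rfl, ?_, ?_⟩
  · have := T.top_lastTop
    omega
  · rw [Function.iterate_one, map_eq h.len_pos (p_mem_subinterval h.len_pos _)]
    linarith [T.p_lastTop, T.q_lastBot]

section Top

variable (h : T.TopType)
include h

theorem winner_of_topType : T.winner = T.lastTop := by simp [winner, h]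

theorem loser_of_topType : T.loser = T.lastBot := by simp [loser, h]

theorem rauzyStep_top_of_topType : T.rauzyStep.top = T.top := by simp [rauzyStep, h]

theorem rauzyStep_bot_of_topType :
    T.rauzyStep.bot = T.bot.trans (moveLast (T.bot T.lastTop)) := by simp [rauzyStep, h]

end Top

section Bottom

variable (h : ¬ T.TopType)
include h

theorem winner_of_not_topType : T.winner = T.lastBot := by simp [winner, h]

theorem loser_of_not_topType : T.loser = T.lastTop := by simp [loser, h]

theorem rauzyStep_bot_of_not_topType : T.rauzyStep.bot = T.bot := by simp [rauzyStep, h]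

theorem rauzyStep_top_of_not_topType :
    T.rauzyStep.top = T.top.trans (moveLast (T.top T.lastBot)) := by simp [rauzyStep, h]

end Bottom

theorem rauzyStep_len : T.rauzyStep.len =
    Function.update T.len T.winner (T.len T.winner - T.len T.loser) := rfl

theorem Regular.loser_lt_winner (hd : 2 ≤ d) (h : T.Regular) :
    T.len T.loser < T.len T.winner := by
  by_cases ht : T.TopType
  · rw [winner_of_topType ht, loser_of_topType ht]
    exact ht
  · rw [winner_of_not_topType ht, loser_of_not_topType ht]
    exact lt_of_le_of_ne (not_lt.mp ht) (h.len_lastTop_ne hd)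

theorem Regular.winner_ne_loser (hd : 2 ≤ d) (h : T.Regular) : T.winner ≠ T.loser := fun heq =>
  (h.loser_lt_winner hd).ne (by rw [heq])

theorem Regular.loser_le_lastTop (hd : 2 ≤ d) (h : T.Regular) :
    T.len T.loser ≤ T.len T.lastTop := by
  have := h.loser_lt_winner hd
  by_cases ht : T.TopType
  · rw [winner_of_topType ht] at this
    exact this.le
  · rw [loser_of_not_topType ht]

theorem Regular.loser_le_lastBot (hd : 2 ≤ d) (h : T.Regular) :
    T.len T.loser ≤ T.len T.lastBot := by
  have := h.loser_lt_winner hd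
  by_cases ht : T.TopType
  · rw [loser_of_topType ht]
  · rw [winner_of_not_topType ht] at this
    exact this.le

theorem Regular.rauzyStep_len_pos (hd : 2 ≤ d) (h : T.Regular) (α : 𝒜) :
    0 < T.rauzyStep.len α := by
  rw [rauzyStep_len]
  by_cases hα : α = T.winner
  · rw [hα, Function.update_self]
    linarith [h.loser_lt_winner hd]
  · rw [Function.update_of_ne hα]
    exact h.len_pos α

theorem Regular.rauzyStep_len_le (h : T.Regular) (α : 𝒜) : T.rauzyStep.len α ≤ T.len α := by
  rw [rauzyStep_len]
  by_cases hα : α = T.winner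
  · rw [hα, Function.update_self]
    linarith [h.len_pos T.loser]
  · rw [Function.update_of_ne hα]

theorem Regular.rauzyStep_len_loser (hd : 2 ≤ d) (h : T.Regular) :
    T.rauzyStep.len T.loser = T.len T.loser := by
  rw [rauzyStep_len, Function.update_of_ne (h.winner_ne_loser hd).symm]

theorem total_rauzyStep : T.rauzyStep.total = T.total - T.len T.loser := by
  rw [total, total, rauzyStep_len, Finset.sum_update_of_mem (Finset.mem_univ _),
    ← Finset.add_sum_erase _ _ (Finset.mem_univ T.winner), Finset.sdiff_singleton_eq_erase]
  ring

theorem Regular.rauzyStep_p (hd : 2 ≤ d) (h : T.Regular) {α : 𝒜} (hα : α ≠ T.loser) :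
    T.rauzyStep.p α = T.p α := by
  have hne := h.winner_ne_loser hd
  change rowStart _ _ _ = rowStart _ _ _
  rw [rauzyStep_len]
  by_cases ht : T.TopType
  · rw [rauzyStep_top_of_topType ht, rowStart_update]
    rw [winner_of_topType ht]
    exact T.top_lastTop
  · rw [rauzyStep_top_of_not_topType ht, ← winner_of_not_topType ht]
    refine rowStart_moveLast _ _ hne ?_ hα
    rw [loser_of_not_topType ht]
    exact T.top_lastTop

theorem Regular.rauzyStep_q (hd : 2 ≤ d) (h : T.Regular) {α : 𝒜} (hα : α ≠ T.loser) :
    T.rauzyStep.q α = T.q α := by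
  have hne := h.winner_ne_loser hd
  change rowStart _ _ _ = rowStart _ _ _
  rw [rauzyStep_len]
  by_cases ht : T.TopType
  · rw [rauzyStep_bot_of_topType ht, ← winner_of_topType ht]
    refine rowStart_moveLast _ _ hne ?_ hα
    rw [loser_of_topType ht]
    exact T.bot_lastBot
  · rw [rauzyStep_bot_of_not_topType ht, rowStart_update]
    rw [winner_of_not_topType ht]
    exact T.bot_lastBot

/-- One formula serves both types: the new subinterval of the loser is the right end part of the old
subinterval of `lastBot` (all of it for the top type). This allows the tower argument to avoid a
case distinction. -/
theorem Regular.rauzyStep_p_loser (hd : 2 ≤ d) (h : T.Regular) :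
    T.rauzyStep.p T.loser = T.p T.lastBot + T.len T.lastBot - T.len T.loser := by
  have hne := h.winner_ne_loser hd
  change rowStart _ _ _ = rowStart _ _ _ + _ - _
  rw [rauzyStep_len]
  by_cases ht : T.TopType
  · rw [rauzyStep_top_of_topType ht, rowStart_update, loser_of_topType ht]
    · ring
    rw [winner_of_topType ht]
    exact T.top_lastTop
  · rw [rauzyStep_top_of_not_topType ht, ← winner_of_not_topType ht, rowStart_moveLast_self _ _ hne]
    rw [loser_of_not_topType ht]
    exact T.top_lastTop

theorem Regular.rauzyStep_q_loser (hd : 2 ≤ d) (h : T.Regular) :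
    T.rauzyStep.q T.loser = T.q T.lastTop + T.len T.lastTop - T.len T.loser := by
  have hne := h.winner_ne_loser hd
  change rowStart _ _ _ = rowStart _ _ _ + _ - _
  rw [rauzyStep_len]
  by_cases ht : T.TopType
  · rw [rauzyStep_bot_of_topType ht, ← winner_of_topType ht, rowStart_moveLast_self _ _ hne]
    rw [loser_of_topType ht]
    exact T.bot_lastBot
  · rw [rauzyStep_bot_of_not_topType ht, rowStart_update, loser_of_not_topType ht]
    · ring
    rw [winner_of_not_topType ht]
    exact T.bot_lastBot

theorem Regular.rauzyStep_subinterval_subset (hd : 2 ≤ d) (h : T.Regular) {α : 𝒜}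
    (hα : α ≠ T.loser) : T.rauzyStep.subinterval α ⊆ T.subinterval α := by
  intro x hx
  rw [subinterval, h.rauzyStep_p hd hα] at hx
  exact ⟨hx.1, hx.2.trans_le (by linarith [h.rauzyStep_len_le α])⟩

theorem Regular.rauzyStep_domain_subset (h : T.Regular) : T.rauzyStep.domain ⊆ T.domain := by
  intro x hx
  refine ⟨hx.1, hx.2.trans_le ?_⟩
  rw [total_rauzyStep]
  linarith [h.len_pos T.loser]

theorem Regular.rauzyStep_map_of_ne (hd : 2 ≤ d) (h : T.Regular) {α : 𝒜} (hα : α ≠ T.loser)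
    {x : ℝ} (hx : x ∈ T.rauzyStep.subinterval α) : T.rauzyStep.map x = T.map x := by
  rw [map_eq (h.rauzyStep_len_pos hd) hx,
    map_eq h.len_pos (h.rauzyStep_subinterval_subset hd hα hx), h.rauzyStep_p hd hα,
    h.rauzyStep_q hd hα]

theorem Regular.rauzyStep_subinterval_loser_subset (hd : 2 ≤ d) (h : T.Regular) :
    T.rauzyStep.subinterval T.loser ⊆ T.subinterval T.lastBot := by
  intro x hx
  rw [subinterval, h.rauzyStep_p_loser hd, h.rauzyStep_len_loser hd] at hx
  have := h.loser_le_lastBot hd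
  exact ⟨by linarith [hx.1], by linarith [hx.2]⟩

/-- The subinterval of the loser is mapped by `T` into the part of the domain which is cut off. -/
theorem Regular.total_rauzyStep_le_map (hd : 2 ≤ d) (h : T.Regular) {x : ℝ}
    (hx : x ∈ T.rauzyStep.subinterval T.loser) : T.rauzyStep.total ≤ T.map x := by
  rw [map_eq h.len_pos (h.rauzyStep_subinterval_loser_subset hd hx), total_rauzyStep]
  rw [subinterval, h.rauzyStep_p_loser hd] at hx
  linarith [hx.1, T.q_lastBot]

theorem Regular.mem_lastTop_of_le (hd : 2 ≤ d) (h : T.Regular) {x : ℝ}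
    (hx : T.rauzyStep.total ≤ x) (hx' : x < T.total) : x ∈ T.subinterval T.lastTop := by
  rw [total_rauzyStep] at hx
  exact ⟨by linarith [T.p_lastTop, h.loser_le_lastTop hd], by linarith [T.p_lastTop]⟩

theorem Regular.map_mem_lastTop (hd : 2 ≤ d) (h : T.Regular) {x : ℝ}
    (hx : x ∈ T.rauzyStep.subinterval T.loser) : T.map x ∈ T.subinterval T.lastTop :=
  h.mem_lastTop_of_le hd (h.total_rauzyStep_le_map hd hx)
    (mapsTo_map h.len_pos (subinterval_subset_domain h.len_pos _
      (h.rauzyStep_subinterval_loser_subset hd hx))).2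

/-- The first image falls into the cut-off part, hence into the subinterval of `lastTop`; a second
application of T brings the point back. -/
theorem Regular.rauzyStep_map_loser (hd : 2 ≤ d) (h : T.Regular) {x : ℝ}
    (hx : x ∈ T.rauzyStep.subinterval T.loser) : T.rauzyStep.map x = T.map (T.map x) := by
  rw [map_eq (h.rauzyStep_len_pos hd) hx, map_eq h.len_pos (h.map_mem_lastTop hd hx),
    map_eq h.len_pos (h.rauzyStep_subinterval_loser_subset hd hx), h.rauzyStep_p_loser hd,
    h.rauzyStep_q_loser hd]
  linarith [T.p_lastTop, T.q_lastBot]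

/-- The part of the domain which is cut off is covered by the image of the subinterval of the
loser. -/
theorem Regular.exists_map_eq (hd : 2 ≤ d) (h : T.Regular) {x : ℝ}
    (hx : T.rauzyStep.total ≤ x) (hx' : x < T.total) :
    ∃ y ∈ T.rauzyStep.subinterval T.loser, T.map y = x := by
  rw [total_rauzyStep] at hx
  have hy : x + (T.p T.lastBot - T.q T.lastBot) ∈ T.rauzyStep.subinterval T.loser := by
    rw [subinterval, h.rauzyStep_p_loser hd, h.rauzyStep_len_loser hd]
    exact ⟨by linarith [T.q_lastBot], by linarith [T.q_lastBot]⟩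
  refine ⟨_, hy, ?_⟩
  rw [map_eq h.len_pos (h.rauzyStep_subinterval_loser_subset hd hy)]
  ring

theorem Regular.rauzyStep_admissible (h : T.Regular) : T.rauzyStep.Admissible := by
  intro k hk hkd heq
  refine h.admissible k hk hkd ?_
  by_cases ht : T.TopType
  · rw [rauzyStep_top_of_topType ht, rauzyStep_bot_of_topType ht] at heq
    exact setOf_moveLast_lt T.bot T.top T.top_lastTop hkd heq
  · rw [rauzyStep_top_of_not_topType ht, rauzyStep_bot_of_not_topType ht] at heq
    exact (setOf_moveLast_lt T.top T.bot T.bot_lastBot hkd heq.symm).symm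

theorem Regular.exists_iterate_eq_rauzyStep_map (hd : 2 ≤ d) (h : T.Regular) {x : ℝ}
    (hx : x ∈ T.rauzyStep.domain) (m : ℕ) : ∃ k, m ≤ k ∧ T.map^[k] x = T.rauzyStep.map^[m] x := by
  induction m with
  | zero => exact ⟨0, le_rfl, rfl⟩
  | succ m ih =>
    obtain ⟨k, hk, hkx⟩ := ih
    obtain ⟨α, hα⟩ := exists_mem_subinterval
      ((mapsTo_map (h.rauzyStep_len_pos hd)).iterate m hx)
    rw [Function.iterate_succ_apply']
    by_cases hl : α = T.loser
    · subst hl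
      rw [h.rauzyStep_map_loser hd hα]
      exact ⟨k + 2, by omega, by
        rw [Function.iterate_succ_apply', Function.iterate_succ_apply', hkx]⟩
    · rw [h.rauzyStep_map_of_ne hd hl hα]
      exact ⟨k + 1, by omega, by rw [Function.iterate_succ_apply', hkx]⟩

/-- The second alternative arises for the loser of a step of bottom type, whose new left end is one
T-step before the old one. -/
theorem Regular.rauzyStep_p_or (hd : 2 ≤ d) (h : T.Regular) (α : 𝒜) :
    T.rauzyStep.p α = T.p α ∨ α = T.loser ∧ T.map (T.rauzyStep.p α) = T.p α := by
  by_cases hα : α = T.loser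
  · by_cases ht : T.TopType
    · left
      rw [hα, h.rauzyStep_p_loser hd, loser_of_topType ht]
      ring
    · right
      refine ⟨hα, ?_⟩
      have hmem : T.rauzyStep.p T.loser ∈ T.subinterval T.lastBot :=
        h.rauzyStep_subinterval_loser_subset hd (p_mem_subinterval (h.rauzyStep_len_pos hd) _)
      rw [hα, map_eq h.len_pos hmem, h.rauzyStep_p_loser hd, loser_of_not_topType ht]
      linarith [T.p_lastTop, T.q_lastBot]
  · exact Or.inl (h.rauzyStep_p hd hα)

theorem top_pos_of_rauzyStep {α : 𝒜} (hα : 0 < (T.rauzyStep.top α : ℕ)) :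
    0 < (T.top α : ℕ) := by
  by_cases ht : T.TopType
  · rwa [rauzyStep_top_of_topType ht] at hα
  · by_contra hc
    rw [rauzyStep_top_of_not_topType ht, Equiv.trans_apply, moveLast_of_le] at hα
    · exact hc hα
    · rw [Fin.le_def]
      omega

theorem Regular.rauzyStep_keane (hd : 2 ≤ d) (h : T.Regular) : T.rauzyStep.Keane := by
  rintro ⟨α, β, m, hm, hβ, heq⟩
  have hlen' := h.rauzyStep_len_pos hd
  -- The clause for `α = β` anticipates that one step of the orbit may be lost when `p α` replaces
  -- the new left end: it prevents the remaining connection from having length 0.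
  have key : ∃ k, 1 ≤ k ∧ (α = β → 2 ≤ k ∨ T.rauzyStep.p α = T.p α) ∧
      T.map^[k] (T.rauzyStep.p α) = T.p β := by
    obtain ⟨k, hk, hkx⟩ := h.exists_iterate_eq_rauzyStep_map hd (p_mem_domain hlen' α) m
    rcases h.rauzyStep_p_or hd β with hp | ⟨-, hp⟩
    · exact ⟨k, by omega, by rintro rfl; exact Or.inr hp, by rw [hkx, heq, hp]⟩
    · exact ⟨k + 1, by omega, fun _ => Or.inl (by omega), by
        rw [Function.iterate_succ_apply', hkx, heq, hp]⟩
  obtain ⟨k, hk, hαβ, hkx⟩ := key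
  rcases h.rauzyStep_p_or hd α with hp | ⟨-, hp⟩
  · exact h.keane ⟨α, β, k, hk, top_pos_of_rauzyStep hβ, hp ▸ hkx⟩
  · obtain ⟨k, rfl⟩ : ∃ j, k = j + 1 := ⟨k - 1, by omega⟩
    rw [Function.iterate_succ_apply, hp] at hkx
    rcases Nat.eq_zero_or_pos k with rfl | hk0
    · have := p_injective h.len_pos hkx
      rcases hαβ this with h2 | h2
      · omega
      · refine h.keane ⟨α, α, 1, le_rfl, ?_, ?_⟩
        · exact this ▸ top_pos_of_rauzyStep hβ
        · rw [Function.iterate_one]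
          rwa [h2] at hp
    · exact h.keane ⟨α, β, k, hk0, top_pos_of_rauzyStep hβ, hkx⟩

theorem Regular.rauzyStep (hd : 2 ≤ d) (h : T.Regular) : T.rauzyStep.Regular :=
  ⟨h.rauzyStep_len_pos hd, h.rauzyStep_admissible, h.rauzyStep_keane hd⟩

theorem renorm_succ (n : ℕ) : T.renorm (n + 1) = (T.renorm n).rauzyStep :=
  Function.iterate_succ_apply' _ _ _

theorem Regular.renorm (hd : 2 ≤ d) (h : T.Regular) (n : ℕ) : (T.renorm n).Regular := by
  induction n with
  | zero => exact h
  | succ n ih =>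
    rw [renorm_succ]
    exact ih.rauzyStep hd

/-- If the winner changes, then the old winner is the new loser. -/
theorem loser_rauzyStep (hne : T.rauzyStep.winner ≠ T.winner) :
    T.rauzyStep.loser = T.winner := by
  by_cases ht : T.TopType
  · have h1 : T.rauzyStep.lastTop = T.lastTop := by
      rw [lastTop, rauzyStep_top_of_topType ht, lastTop]
    rw [winner_of_topType ht] at hne ⊢
    by_cases ht' : T.rauzyStep.TopType
    · rw [winner_of_topType ht'] at hne
      exact absurd h1 hne
    · rw [loser_of_not_topType ht', h1]
  · have h1 : T.rauzyStep.lastBot = T.lastBot := by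
      rw [lastBot, rauzyStep_bot_of_not_topType ht, lastBot]
    rw [winner_of_not_topType ht] at hne ⊢
    by_cases ht' : T.rauzyStep.TopType
    · rw [loser_of_topType ht', h1]
    · rw [winner_of_not_topType ht'] at hne
      exact absurd h1 hne

end Step

/-! ### Rokhlin towers over the intervals of the renormalized maps -/

section Tower

variable {𝒜 : Type*} [Fintype 𝒜] {d : ℕ}

/-- `S` is the map of first return of `T` to the domain of `S`, with return time `r α` on the
subinterval `α` of `S`; the domain of `T` is filled by the orbits up to the return, and up to the
return every subinterval of `S` is translated inside one subinterval of `T`. -/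
structure IsTower (T S : IntervalExchange 𝒜 d) (r : 𝒜 → ℕ) : Prop where
  subset : S.domain ⊆ T.domain
  iterate_eq : ∀ α, ∀ x ∈ S.subinterval α, T.map^[r α] x = S.map x
  le_iterate : ∀ α, ∀ x ∈ S.subinterval α, ∀ j, 0 < j → j < r α → S.total ≤ T.map^[j] x
  cover : ∀ y ∈ T.domain, ∃ α, ∃ x ∈ S.subinterval α, ∃ j < r α, T.map^[j] x = y
  translate : ∀ α, ∀ j < r α, ∃ β c, ∀ x ∈ S.subinterval α,
    T.map^[j] x = x + c ∧ x + c ∈ T.subinterval β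

theorem IsTower.refl (T : IntervalExchange 𝒜 d) : IsTower T T fun _ => 1 where
  subset := le_rfl
  iterate_eq _ _ _ := rfl
  le_iterate _ _ _ j h h' := by omega
  cover y hy := by
    obtain ⟨α, hα⟩ := exists_mem_subinterval hy
    exact ⟨α, y, hα, 0, one_pos, rfl⟩
  translate α j hj := by
    obtain rfl : j = 0 := by omega
    exact ⟨α, 0, fun x hx => ⟨by simp, by simpa using hx⟩⟩

section

variable {T S : IntervalExchange 𝒜 d} {r : 𝒜 → ℕ}

/-- Cancelling the smaller power of T puts one base point on the orbit of the other strictly before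
its return, unless the two powers agree. -/
theorem IsTower.injective (h : IsTower T S r) (hT : ∀ α, 0 < T.len α) (hS : ∀ α, 0 < S.len α)
    {α β : 𝒜} {x y : ℝ} {i j : ℕ} (hx : x ∈ S.subinterval α) (hy : y ∈ S.subinterval β)
    (hi : i < r α) (hj : j < r β) (heq : T.map^[i] x = T.map^[j] y) : x = y := by
  wlog hij : i ≤ j generalizing α β x y i j
  · exact (this hy hx hj hi heq.symm (le_of_not_ge hij)).symm
  have hxS := subinterval_subset_domain hS _ hx
  have hyT := h.subset (subinterval_subset_domain hS _ hy)
  have hinj : Set.InjOn T.map^[i] T.domain := (injOn_map hT).iterate (mapsTo_map hT) i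
  obtain ⟨k, rfl⟩ := Nat.exists_eq_add_of_le hij
  rw [Function.iterate_add_apply] at heq
  have hxy := hinj (h.subset hxS) ((mapsTo_map hT).iterate k hyT) heq
  rcases Nat.eq_zero_or_pos k with rfl | hk
  · exact hxy
  · have := h.le_iterate β y hy k hk (by omega)
    rw [← hxy] at this
    exact absurd hxS.2 (not_lt.mpr this)

/-- A floor lies inside a single subinterval of T, so it can contain the left end of that
subinterval only as its own left end. -/
theorem IsTower.eq_p (h : IsTower T S r) (hT : ∀ α, 0 < T.len α) (hS : ∀ α, 0 < S.len α)
    {α β : 𝒜} {x : ℝ} {i : ℕ} (hx : x ∈ S.subinterval α) (hi : i < r α)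
    (heq : T.map^[i] x = T.p β) : x = S.p α := by
  obtain ⟨γ, c, hc⟩ := h.translate α i hi
  have h1 := hc x hx
  have h2 := (hc _ (p_mem_subinterval hS α)).2
  rw [h1.1] at heq
  obtain rfl : β = γ := eq_of_mem_row T.top hT (p_mem_subinterval hT β) (heq ▸ h1.2)
  have := h2.1
  exact le_antisymm (by linarith) hx.1

/-- The left ends of the floors of the towers. -/
def towerEnds (T S : IntervalExchange 𝒜 d) (r : 𝒜 → ℕ) : Set ℝ :=
  {y | ∃ α, ∃ j < r α, T.map^[j] (S.p α) = y}

theorem IsTower.le_sub_of_lt (h : IsTower T S r) (hT : ∀ α, 0 < T.len α)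
    (hS : ∀ α, 0 < S.len α) {c : ℝ} (hc : ∀ α, c ≤ S.len α) {y z : ℝ}
    (hy : y ∈ towerEnds T S r) (hz : z ∈ towerEnds T S r) (hyz : y < z) : c ≤ z - y := by
  obtain ⟨α, i, hi, rfl⟩ := hy
  obtain ⟨β, j, hj, rfl⟩ := hz
  obtain ⟨γ, t, ht⟩ := h.translate α i hi
  have hα := (ht _ (p_mem_subinterval hS α)).1
  by_contra hlt
  -- If the gap were below `c`, the second point would lie in the floor that starts at the first
  -- one; disjointness of floors then identifies the two.
  have hx : T.map^[j] (S.p β) - t ∈ S.subinterval α :=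
    ⟨by linarith, by linarith [hc α]⟩
  have hx' := (ht _ hx).1
  rw [sub_add_cancel] at hx'
  have heq := h.injective hT hS hx (p_mem_subinterval hS β) hi hj hx'
  obtain rfl : α = β := eq_of_mem_row S.top hS hx (by
    rw [heq]
    exact p_mem_subinterval hS β)
  rw [heq] at hx'
  exact hyz.ne hx'

theorem IsTower.le_total_sub (h : IsTower T S r) (hT : ∀ α, 0 < T.len α)
    (hS : ∀ α, 0 < S.len α) {c : ℝ} (hc : ∀ α, c ≤ S.len α) {y : ℝ}
    (hy : y ∈ towerEnds T S r) : c ≤ T.total - y := by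
  obtain ⟨α, i, hi, rfl⟩ := hy
  obtain ⟨γ, t, ht⟩ := h.translate α i hi
  have hα := ht _ (p_mem_subinterval hS α)
  have hlt := (subinterval_subset_domain hT _ hα.2).2
  by_contra hcon
  have hx : T.total - t ∈ S.subinterval α := ⟨by linarith, by linarith [hc α]⟩
  have := (subinterval_subset_domain hT _ (ht _ hx).2).2
  linarith

end

variable [DecidableEq 𝒜] [NeZero d]

theorem IsTower.rauzyStep {T S : IntervalExchange 𝒜 d} {r : 𝒜 → ℕ} (h : IsTower T S r)
    (hd : 2 ≤ d) (hS : S.Regular) :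
    IsTower T S.rauzyStep (Function.update r S.loser (r S.lastBot + r S.lastTop)) := by
  have hsub := hS.rauzyStep_subinterval_loser_subset hd
  -- The new tower of the loser is the tower of `lastBot` with that of `lastTop` stacked on it;
  -- heights from `r S.lastBot` on belong to the upper one.
  have hret : ∀ x ∈ S.rauzyStep.subinterval S.loser, ∀ j,
      T.map^[r S.lastBot + j] x = T.map^[j] (S.map x) := fun x hx j => by
    rw [add_comm, Function.iterate_add_apply, h.iterate_eq _ _ (hsub hx)]
  have htot : S.rauzyStep.total ≤ S.total := by
    rw [total_rauzyStep]
    linarith [hS.len_pos S.loser]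
  refine ⟨hS.rauzyStep_domain_subset.trans h.subset, ?_, ?_, ?_, ?_⟩
  · intro α x hx
    by_cases hα : α = S.loser
    · subst hα
      rw [Function.update_self, hret x hx, h.iterate_eq _ _ (hS.map_mem_lastTop hd hx),
        hS.rauzyStep_map_loser hd hx]
    · rw [Function.update_of_ne hα, hS.rauzyStep_map_of_ne hd hα hx,
        h.iterate_eq _ _ (hS.rauzyStep_subinterval_subset hd hα hx)]
  · intro α x hx j hj hjr
    by_cases hα : α = S.loser
    · subst hα
      rw [Function.update_self] at hjr
      rcases lt_or_ge j (r S.lastBot) with hlt | hge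
      · exact htot.trans (h.le_iterate _ _ (hsub hx) j hj hlt)
      · obtain ⟨k, rfl⟩ := Nat.exists_eq_add_of_le hge
        rw [hret x hx]
        rcases Nat.eq_zero_or_pos k with rfl | hk
        · exact hS.total_rauzyStep_le_map hd hx
        · exact htot.trans (h.le_iterate _ _ (hS.map_mem_lastTop hd hx) k hk (by omega))
    · rw [Function.update_of_ne hα] at hjr
      exact htot.trans (h.le_iterate _ _ (hS.rauzyStep_subinterval_subset hd hα hx) j hj hjr)
  · intro y hy
    obtain ⟨α, x, hx, j, hj, rfl⟩ := h.cover y hy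
    have hxS := subinterval_subset_domain hS.len_pos _ hx
    rcases lt_or_ge x S.rauzyStep.total with hlt | hge
    · obtain ⟨β, hβ⟩ := exists_mem_subinterval (T := S.rauzyStep) ⟨hxS.1, hlt⟩
      refine ⟨β, x, hβ, j, ?_, rfl⟩
      by_cases hl : β = S.loser
      · subst hl
        rw [Function.update_self]
        obtain rfl := eq_of_mem_row S.top hS.len_pos hx (hsub hβ)
        omega
      · rw [Function.update_of_ne hl]
        obtain rfl := eq_of_mem_row S.top hS.len_pos hx
          (hS.rauzyStep_subinterval_subset hd hl hβ)
        exact hj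
    · obtain ⟨z, hz, rfl⟩ := hS.exists_map_eq hd hge hxS.2
      obtain rfl := eq_of_mem_row S.top hS.len_pos hx (hS.map_mem_lastTop hd hz)
      refine ⟨S.loser, z, hz, r S.lastBot + j, ?_, hret z hz j⟩
      rw [Function.update_self]
      omega
  · intro α j hj
    by_cases hα : α = S.loser
    · subst hα
      rw [Function.update_self] at hj
      rcases lt_or_ge j (r S.lastBot) with hlt | hge
      · obtain ⟨β, c, hc⟩ := h.translate _ j hlt
        exact ⟨β, c, fun x hx => hc x (hsub hx)⟩
      · obtain ⟨k, rfl⟩ := Nat.exists_eq_add_of_le hge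
        obtain ⟨β, c, hc⟩ := h.translate S.lastTop k (by omega)
        refine ⟨β, S.q S.lastBot - S.p S.lastBot + c, fun x hx => ?_⟩
        have := hc _ (hS.map_mem_lastTop hd hx)
        rw [hret x hx, ← add_assoc, ← map_eq hS.len_pos (hsub hx)]
        exact this
    · rw [Function.update_of_ne hα] at hj
      obtain ⟨β, c, hc⟩ := h.translate _ j hj
      exact ⟨β, c, fun x hx => hc x (hS.rauzyStep_subinterval_subset hd hα hx)⟩

/-- The return times of `T` to the subintervals of `T(n)`. -/
noncomputable def returnTime (T : IntervalExchange 𝒜 d) : ℕ → 𝒜 → ℕ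
  | 0 => fun _ => 1
  | n + 1 => Function.update (returnTime T n) (T.renorm n).loser
      (returnTime T n (T.renorm n).lastBot + returnTime T n (T.renorm n).lastTop)

theorem Regular.isTower {T : IntervalExchange 𝒜 d} (hd : 2 ≤ d) (h : T.Regular) (n : ℕ) :
    IsTower T (T.renorm n) (T.returnTime n) := by
  induction n with
  | zero => exact IsTower.refl T
  | succ n ih =>
    rw [renorm_succ]
    exact ih.rauzyStep hd (h.renorm hd n)

/-! ### The cocycle, return times and lengths -/

theorem lastBot_add_lastTop (T : IntervalExchange 𝒜 d) (r : 𝒜 → ℕ) :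
    r T.lastBot + r T.lastTop = r T.loser + r T.winner := by
  by_cases ht : T.TopType
  · rw [winner_of_topType ht, loser_of_topType ht]
  · rw [winner_of_not_topType ht, loser_of_not_topType ht, add_comm]

theorem cocycle_succ (T : IntervalExchange 𝒜 d) {m n : ℕ} (h : m ≤ n) :
    T.cocycle m (n + 1) = (T.renorm n).arrowMatrix * T.cocycle m n := by
  rw [cocycle, if_pos h]

theorem cocycle_self (T : IntervalExchange 𝒜 d) (m : ℕ) : T.cocycle m m = 1 := by
  cases m with
  | zero => rfl
  -- Here the default value 1 of `cocycle` for reversed indices supplies the diagonal.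
  | succ m => rw [cocycle, if_neg (by omega)]

theorem arrowMatrix_mul_apply (T : IntervalExchange 𝒜 d) (B : Matrix 𝒜 𝒜 ℤ) (α β : 𝒜) :
    (T.arrowMatrix * B) α β = B α β + if α = T.loser then B T.winner β else 0 := by
  rw [arrowMatrix, add_mul, one_mul, Matrix.add_apply]
  split_ifs with h
  · rw [h, Matrix.single_mul_apply_same, one_mul]
  · rw [Matrix.single_mul_apply_of_ne _ _ _ _ _ h]

theorem cocycle_succ_apply (T : IntervalExchange 𝒜 d) {m n : ℕ} (h : m ≤ n) (α β : 𝒜) :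
    T.cocycle m (n + 1) α β = T.cocycle m n α β +
      if α = (T.renorm n).loser then T.cocycle m n (T.renorm n).winner β else 0 := by
  rw [cocycle_succ T h, arrowMatrix_mul_apply]

theorem cocycle_mul (T : IntervalExchange 𝒜 d) {l m n : ℕ} (hlm : l ≤ m) (hmn : m ≤ n) :
    T.cocycle m n * T.cocycle l m = T.cocycle l n := by
  induction n, hmn using Nat.le_induction with
  | base => rw [cocycle_self, one_mul]
  | succ n hmn ih => rw [cocycle_succ T hmn, cocycle_succ T (hlm.trans hmn), mul_assoc, ih]

theorem cocycle_nonneg (T : IntervalExchange 𝒜 d) {m n : ℕ} (hmn : m ≤ n) (α β : 𝒜) :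
    0 ≤ T.cocycle m n α β := by
  induction n, hmn using Nat.le_induction generalizing α with
  | base =>
    rw [cocycle_self, Matrix.one_apply]
    split_ifs <;> norm_num
  | succ n hmn ih =>
    rw [cocycle_succ_apply T hmn]
    split_ifs
    · exact add_nonneg (ih _) (ih _)
    · exact add_nonneg (ih _) le_rfl

theorem returnTime_eq (T : IntervalExchange 𝒜 d) (n : ℕ) (α : 𝒜) :
    (T.returnTime n α : ℤ) = ∑ β, T.cocycle 0 n α β := by
  induction n generalizing α with
  | zero => simp [returnTime, cocycle, Matrix.one_apply]
  | succ n ih =>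
    simp only [cocycle_succ_apply T (Nat.zero_le n), Finset.sum_add_distrib]
    rw [returnTime, lastBot_add_lastTop]
    by_cases h : α = (T.renorm n).loser
    · subst h
      simp only [Function.update_self, if_true]
      push_cast
      rw [ih, ih]
    · simp only [Function.update_of_ne h, if_neg h, Finset.sum_const_zero, add_zero, ih]

/-- The lengths of `T(m)` in terms of the lengths of `T(n)`. -/
theorem Regular.len_renorm {T : IntervalExchange 𝒜 d} (hd : 2 ≤ d) (h : T.Regular) {m n : ℕ}
    (hmn : m ≤ n) (α : 𝒜) :
    (T.renorm m).len α = ∑ β, (T.renorm n).len β * T.cocycle m n β α := by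
  induction n, hmn using Nat.le_induction with
  | base => simp [cocycle_self, Matrix.one_apply]
  | succ n hmn ih =>
    have hne := (h.renorm hd n).winner_ne_loser hd
    rw [ih]
    simp only [cocycle_succ_apply T hmn, Int.cast_add, mul_add, Finset.sum_add_distrib]
    rw [← sub_eq_iff_eq_add', ← Finset.sum_sub_distrib,
      Finset.sum_eq_single (T.renorm n).winner, Finset.sum_eq_single (T.renorm n).loser,
      if_pos rfl, renorm_succ, rauzyStep_len, Function.update_self,
      Function.update_of_ne hne.symm]
    · ring
    · intro β _ hβ
      simp [hβ]
    · simp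
    · intro β _ hβ
      rw [renorm_succ, rauzyStep_len, Function.update_of_ne hβ, sub_self]
    · simp

theorem Regular.sum_len_mul_returnTime {T : IntervalExchange 𝒜 d} (hd : 2 ≤ d) (h : T.Regular)
    (n : ℕ) : T.total = ∑ β, (T.renorm n).len β * T.returnTime n β := by
  have h0 : ∀ α, T.len α = ∑ β, (T.renorm n).len β * T.cocycle 0 n β α :=
    h.len_renorm hd (Nat.zero_le n)
  rw [total, Finset.sum_congr rfl fun α _ => h0 α, Finset.sum_comm]
  refine Finset.sum_congr rfl fun β _ => ?_
  rw [← Finset.mul_sum, ← Int.cast_natCast, returnTime_eq, Int.cast_sum]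

end Tower

open Filter Topology

/-! ### Every letter wins infinitely often -/

section Recurrence

/-- The letters that are never last in a row from some time on eventually form an initial segment
of this row, if all other letters win infinitely often. -/
theorem exists_forall_lt_mem {𝒜 : Type*} [Finite 𝒜] {d : ℕ} (e : ℕ → 𝒜 ≃ Fin d) (w : ℕ → 𝒜)
    (hstep : ∀ n, ((e n (w n) : ℕ) + 1 = d ∧ e (n + 1) = e n) ∨
      e (n + 1) = (e n).trans (moveLast (e n (w n))))
    (U : Set 𝒜) (hU : ∀ δ ∉ U, ∃ᶠ n in atTop, w n = δ)
    (hlast : ∀ᶠ n in atTop, ∀ γ ∈ U, (e n γ : ℕ) + 1 ≠ d) :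
    ∀ᶠ n in atTop, ∀ γ ∈ U, ∀ δ, e n δ < e n γ → δ ∈ U := by
  obtain ⟨N, hN⟩ := eventually_atTop.mp hlast
  -- A letter that is not last can only be pushed to the right, so its position is monotone and,
  -- positions being finite in number, eventually constant.
  have hmono : ∀ γ ∈ U, Monotone fun n => e (N + n) γ := fun γ hγ =>
    monotone_nat_of_le_succ fun n => by
      change e (N + n) γ ≤ e (N + n + 1) γ
      rcases hstep (N + n) with ⟨-, h⟩ | h
      · rw [h]
      · rw [h, Equiv.trans_apply]
        exact le_moveLast (hN _ (by omega) γ hγ)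
  have hconst : ∀ᶠ n in atTop, ∀ γ ∈ U, e (n + 1) γ = e n γ := by
    rw [eventually_all]
    intro γ
    by_cases hγ : γ ∈ U
    · obtain ⟨k, hk⟩ := WellFoundedGT.monotone_chain_condition
        (⟨fun n => e (N + n) γ, hmono γ hγ⟩ : ℕ →o Fin d)
      filter_upwards [eventually_ge_atTop (N + k)] with n hn _
      obtain ⟨j, rfl⟩ := Nat.exists_eq_add_of_le hn
      have h1 := hk (k + j) (by omega)
      have h2 := hk (k + j + 1) (by omega)
      simp only [OrderHom.coe_mk] at h1 h2
      rw [add_assoc, add_assoc, add_assoc] at *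
      rw [← h1, ← h2]
    · exact Eventually.of_forall fun n h => absurd h hγ
  obtain ⟨M, hM⟩ := eventually_atTop.mp (hlast.and hconst)
  filter_upwards [eventually_ge_atTop M] with n hn γ hγ δ hδ
  by_contra hδU
  -- As γ no longer moves, all insertions happen behind it, and δ in front of it does not move
  -- either.
  have hstay : ∀ k, e (n + k) δ < e (n + k) γ := by
    intro k
    induction k with
    | zero => exact hδ
    | succ k ih =>
      obtain ⟨h1, h2⟩ := hM (n + k) (by omega)
      have hc := h2 γ hγ
      rw [← add_assoc]
      rcases hstep (n + k) with ⟨-, h⟩ | h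
      · rwa [h]
      · rw [hc]
        rw [h, Equiv.trans_apply] at hc
        rw [h, Equiv.trans_apply, moveLast_of_le]
        · exact ih
        · refine ih.le.trans (not_lt.mp fun hlt => ?_)
          have := moveLast_of_lt hlt (h1 γ hγ)
          rw [hc] at this
          omega
  -- A win of δ would require δ to be last, or would insert a letter right after δ and so move γ.
  obtain ⟨m, hm, hw⟩ := frequently_atTop.mp (hU δ hδU) n
  obtain ⟨k, rfl⟩ := Nat.exists_eq_add_of_le hm
  obtain ⟨h1, h2⟩ := hM (n + k) (by omega)
  have hc := h2 γ hγ
  have hlt := hstay k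
  rcases hstep (n + k) with ⟨h, -⟩ | h
  · rw [hw] at h
    rw [Fin.lt_def] at hlt
    omega
  · rw [h, Equiv.trans_apply, hw] at hc
    have := moveLast_of_lt hlt (h1 γ hγ)
    rw [hc] at this
    omega

theorem eq_setOf_lt_ncard {𝒜 : Type*} [Finite 𝒜] {d : ℕ} (e : 𝒜 ≃ Fin d) (U : Set 𝒜)
    (h : ∀ γ ∈ U, ∀ δ, e δ < e γ → δ ∈ U) : {α | (e α : ℕ) < U.ncard} = U := by
  have hle : ∀ a : Fin d, {α | e α < a}.ncard = a := fun a => by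
    have : {α | e α < a} = e.symm '' (Set.Iio a) := by
      rw [Equiv.image_symm_eq_preimage]
      rfl
    rw [this, Set.ncard_image_of_injective _ e.symm.injective, ← Finset.coe_Iio,
      Set.ncard_coe_finset, Fin.card_Iio]
  ext α
  rw [Set.mem_ofPred_eq]
  constructor
  · intro hα
    by_contra hαU
    have hsub : U ⊆ {β | e β < e α} := fun γ hγ => by
      rw [Set.mem_ofPred_eq]
      by_contra hc
      rcases (not_lt.mp hc).eq_or_lt with heq | hlt
      · exact hαU (e.injective heq ▸ hγ)
      · exact hαU (h γ hγ α hlt)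
    have := Set.ncard_le_ncard hsub
    rw [hle] at this
    omega
  · intro hα
    have hsub : {β | e β < e α} ⊂ U := by
      refine ⟨fun δ hδ => h α hα δ hδ, fun hc => ?_⟩
      exact lt_irrefl (e α) (hc hα)
    have := Set.ncard_lt_ncard hsub
    rwa [hle] at this

variable {𝒜 : Type*} [Fintype 𝒜] [DecidableEq 𝒜] {d : ℕ} [NeZero d]
  {T : IntervalExchange 𝒜 d}

/-- Without further wins the length of α stays constant, and each loss removes that length from the
total; but the totals decrease to a limit, so the removed lengths tend to 0. -/
theorem frequently_winner_of_frequently_loser (hd : 2 ≤ d) (h : T.Regular) {α : 𝒜}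
    (hα : ∃ᶠ n in atTop, (T.renorm n).loser = α) : ∃ᶠ n in atTop, (T.renorm n).winner = α := by
  intro hw
  obtain ⟨N, hN⟩ := eventually_atTop.mp hw
  have hconst : ∀ n, N ≤ n → (T.renorm n).len α = (T.renorm N).len α := by
    intro n hn
    induction n, hn using Nat.le_induction with
    | base => rfl
    | succ n hn ih =>
      rw [renorm_succ, rauzyStep_len, Function.update_of_ne (Ne.symm (hN n hn)), ih]
  have hsucc : ∀ n, (T.renorm (n + 1)).total =
      (T.renorm n).total - (T.renorm n).len (T.renorm n).loser := fun n => by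
    rw [renorm_succ, total_rauzyStep]
  have hanti : Antitone fun n => (T.renorm n).total := antitone_nat_of_succ_le fun n => by
    rw [hsucc]
    linarith [(h.renorm hd n).len_pos (T.renorm n).loser]
  have hlim := tendsto_atTop_ciInf hanti ⟨0, by
    rintro _ ⟨n, rfl⟩
    exact (total_pos (h.renorm hd n).len_pos).le⟩
  have hdiff := hlim.sub (hlim.comp (tendsto_add_atTop_nat 1))
  rw [sub_self] at hdiff
  have hev := hdiff.eventually_lt_const ((h.renorm hd N).len_pos α)
  obtain ⟨n, ⟨hn, hlt⟩, hNn⟩ := ((hα.and_eventually hev).and_eventually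
    (eventually_ge_atTop N)).exists
  simp only [Function.comp_apply, hsucc, hn, hconst n hNn] at hlt
  linarith

/-- Letters that win only finitely often also lose only finitely often, so eventually they are never
last in either row. They then form an initial segment of both rows, of the same size, which
admissibility forbids. -/
theorem frequently_winner (hd : 2 ≤ d) (h : T.Regular) (α : 𝒜) :
    ∃ᶠ n in atTop, (T.renorm n).winner = α := by
  set U : Set 𝒜 := {α | ¬ ∃ᶠ n in atTop, (T.renorm n).winner = α} with hUdef
  by_contra hα
  have hαU : α ∈ U := hα
  have hUc : ∀ δ ∉ U, ∃ᶠ n in atTop, (T.renorm n).winner = δ := fun δ hδ => not_not.mp hδ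
  have hne : ∀ᶠ n in atTop, ∀ γ ∈ U, (T.renorm n).winner ≠ γ ∧ (T.renorm n).loser ≠ γ := by
    rw [eventually_all]
    intro γ
    by_cases hγ : γ ∈ U
    · filter_upwards [not_frequently.mp hγ, not_frequently.mp fun hl =>
        hγ (frequently_winner_of_frequently_loser hd h hl)] with n h1 h2 _ using ⟨h1, h2⟩
    · exact Eventually.of_forall fun n h => absurd h hγ
  have hlast : ∀ᶠ n in atTop, ∀ γ ∈ U, γ ≠ (T.renorm n).lastTop ∧ γ ≠ (T.renorm n).lastBot := by
    filter_upwards [hne] with n hn γ hγ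
    obtain ⟨h1, h2⟩ := hn γ hγ
    by_cases ht : (T.renorm n).TopType
    · rw [winner_of_topType ht] at h1
      rw [loser_of_topType ht] at h2
      exact ⟨h1.symm, h2.symm⟩
    · rw [winner_of_not_topType ht] at h1
      rw [loser_of_not_topType ht] at h2
      exact ⟨h2.symm, h1.symm⟩
  have htop := exists_forall_lt_mem (fun n => (T.renorm n).top) (fun n => (T.renorm n).winner)
    (fun n => by
      rw [renorm_succ]
      by_cases ht : (T.renorm n).TopType
      · rw [winner_of_topType ht, rauzyStep_top_of_topType ht]
        exact Or.inl ⟨top_lastTop _, rfl⟩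
      · rw [winner_of_not_topType ht, rauzyStep_top_of_not_topType ht]
        exact Or.inr rfl) U hUc
    (by filter_upwards [hlast] with n hn γ hγ heq using (hn γ hγ).1 (eq_lastTop heq))
  have hbot := exists_forall_lt_mem (fun n => (T.renorm n).bot) (fun n => (T.renorm n).winner)
    (fun n => by
      rw [renorm_succ]
      by_cases ht : (T.renorm n).TopType
      · rw [winner_of_topType ht, rauzyStep_bot_of_topType ht]
        exact Or.inr rfl
      · rw [winner_of_not_topType ht, rauzyStep_bot_of_not_topType ht]
        exact Or.inl ⟨bot_lastBot _, rfl⟩) U hUc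
    (by filter_upwards [hlast] with n hn γ hγ heq using (hn γ hγ).2 (eq_lastBot heq))
  obtain ⟨n, h1, h2, h3⟩ := (htop.and (hbot.and hne)).exists
  refine (h.renorm hd n).admissible U.ncard ?_ ?_ ?_
  · exact (Set.ncard_pos (Set.toFinite U)).mpr ⟨α, hαU⟩
  · have hcard : Nat.card 𝒜 = d := by rw [Nat.card_congr T.top, Nat.card_fin]
    rw [← hcard, ← Set.ncard_univ]
    refine Set.ncard_lt_ncard ⟨Set.subset_univ _, fun hc => ?_⟩
    exact (h3 _ (hc (Set.mem_univ (T.renorm n).winner))).1 rfl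
  · rw [eq_setOf_lt_ncard _ U h1, eq_setOf_lt_ncard _ U h2]

/-! ### The Marmi–Moussa–Yoccoz acceleration -/

theorem mmyTime_succ_spec (hd : 2 ≤ d) (h : T.Regular) (k : ℕ) :
    T.mmyTime k < T.mmyTime (k + 1) ∧
      ∀ α, ∃ j, T.mmyTime k ≤ j ∧ j ≤ T.mmyTime (k + 1) ∧ (T.renorm j).winner = α := by
  set A : Set ℕ := {m : ℕ | T.mmyTime k < m ∧
      ∃ α : 𝒜, ∀ j : ℕ, T.mmyTime k ≤ j → j < m → (T.renorm j).winner ≠ α} with hA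
  have hsup : T.mmyTime (k + 1) = sSup A := rfl
  have hne : A.Nonempty := by
    -- A block of a single step qualifies, since its loser does not win.
    refine ⟨T.mmyTime k + 1, by omega, (T.renorm (T.mmyTime k)).loser, fun j h1 h2 => ?_⟩
    obtain rfl : j = T.mmyTime k := by omega
    exact (h.renorm hd _).winner_ne_loser hd
  have hbdd : BddAbove A := by
    choose f hf hfw using fun α => frequently_atTop.mp (frequently_winner hd h α) (T.mmyTime k)
    refine ⟨∑ α, f α, fun m hm => ?_⟩
    obtain ⟨-, α, hα⟩ := hm
    by_contra hlt
    have := Finset.single_le_sum (f := f) (fun _ _ => Nat.zero_le _) (Finset.mem_univ α)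
    exact hα (f α) (hf α) (by omega) (hfw α)
  have hmem := Nat.sSup_mem hne hbdd
  rw [← hsup] at hmem
  refine ⟨hmem.1, fun α => ?_⟩
  by_contra hcon
  push Not at hcon
  have := le_csSup hbdd (show T.mmyTime (k + 1) + 1 ∈ A from
    ⟨hmem.1.trans (Nat.lt_succ_self _), α, fun j h1 h2 => hcon j h1 (by omega)⟩)
  rw [← hsup] at this
  omega

theorem mmyTime_strictMono (hd : 2 ≤ d) (h : T.Regular) : StrictMono T.mmyTime :=
  strictMono_nat_of_lt_succ fun k => (mmyTime_succ_spec hd h k).1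

/-- By maximality, one step beyond a block all letters have won; that step already belongs to the
next block, so two blocks suffice. -/
theorem exists_winner_eq (hd : 2 ≤ d) (h : T.Regular) (k : ℕ) (α : 𝒜) :
    ∃ j, T.mmyTime k ≤ j ∧ j < T.mmyTime (k + 2) ∧ (T.renorm j).winner = α := by
  obtain ⟨j, h1, h2, h3⟩ := (mmyTime_succ_spec hd h k).2 α
  exact ⟨j, h1, h2.trans_lt (mmyTime_strictMono hd h (by omega)), h3⟩

/-! ### Positivity of products of the accelerated cocycle -/

/-- The support of a column of the matrix `Q(m, n)`. -/
noncomputable def columnSupport (T : IntervalExchange 𝒜 d) (m : ℕ) (α : 𝒜) (n : ℕ) : Finset 𝒜 :=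
  {β | 0 < T.cocycle m n β α}

theorem mem_columnSupport {m n : ℕ} {α β : 𝒜} :
    β ∈ T.columnSupport m α n ↔ 0 < T.cocycle m n β α := by simp [columnSupport]

theorem columnSupport_subset_succ {m n : ℕ} (hmn : m ≤ n) (α : 𝒜) :
    T.columnSupport m α n ⊆ T.columnSupport m α (n + 1) := by
  intro β hβ
  rw [mem_columnSupport] at hβ ⊢
  rw [cocycle_succ_apply T hmn]
  have := T.cocycle_nonneg hmn (T.renorm n).winner α
  split_ifs <;> omega

theorem columnSupport_mono {m n n' : ℕ} (hmn : m ≤ n) (hnn' : n ≤ n') (α : 𝒜) :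
    T.columnSupport m α n ⊆ T.columnSupport m α n' := by
  induction n', hnn' using Nat.le_induction with
  | base => exact le_rfl
  | succ n' hn ih => exact ih.trans (columnSupport_subset_succ (hmn.trans hn) α)

theorem loser_mem_columnSupport {m n : ℕ} (hmn : m ≤ n) {α : 𝒜}
    (hw : (T.renorm n).winner ∈ T.columnSupport m α n) :
    (T.renorm n).loser ∈ T.columnSupport m α (n + 1) := by
  rw [mem_columnSupport] at hw ⊢
  rw [cocycle_succ_apply T hmn, if_pos rfl]
  have := T.cocycle_nonneg hmn (T.renorm n).loser α
  omega

/-- Suppose the support stays equal to `U`. A letter outside `U` wins in the first two blocks and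
one inside `U` in the last two, so the winner enters `U` at some step. The previous winner, outside
`U`, is the loser of that step and is thereby added to the support. -/
theorem columnSupport_ssubset (hd : 2 ≤ d) (h : T.Regular) {m k : ℕ} (hmk : m ≤ T.mmyTime k)
    {α : 𝒜} (hne : (T.columnSupport m α (T.mmyTime k)).Nonempty)
    (huniv : T.columnSupport m α (T.mmyTime k) ≠ Finset.univ) :
    T.columnSupport m α (T.mmyTime k) ⊂ T.columnSupport m α (T.mmyTime (k + 4)) := by
  have hkk : T.mmyTime k ≤ T.mmyTime (k + 4) := (mmyTime_strictMono hd h).monotone (by omega)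
  refine (columnSupport_mono hmk hkk α).ssubset_of_ne fun heq => ?_
  set U := T.columnSupport m α (T.mmyTime k) with hU
  have hconst : ∀ n, T.mmyTime k ≤ n → n ≤ T.mmyTime (k + 4) → T.columnSupport m α n = U :=
    fun n h1 h2 => ((columnSupport_mono (hmk.trans h1) h2 α).trans heq.ge).antisymm
      (columnSupport_mono hmk h1 α)
  obtain ⟨γ, hγ⟩ := hne
  obtain ⟨δ, hδ⟩ : ∃ δ, δ ∉ U := by
    by_contra hc
    push Not at hc
    exact huniv (Finset.eq_univ_iff_forall.mpr hc)
  obtain ⟨i, hi1, hi2, hi⟩ := exists_winner_eq hd h k δ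
  obtain ⟨j, hj1, hj2, hj⟩ := exists_winner_eq hd h (k + 2) γ
  rw [show k + 2 + 2 = k + 4 by ring] at hj2
  have hstay : ∀ n, i ≤ n → n ≤ j → (T.renorm n).winner ∉ U := by
    intro n hn
    induction n, hn using Nat.le_induction with
    | base => exact fun _ => hi ▸ hδ
    | succ n hn ih =>
      intro hnj hmem
      have hn' := ih (by omega)
      have hchange : (T.renorm n).rauzyStep.winner ≠ (T.renorm n).winner := by
        intro hc
        rw [renorm_succ, hc] at hmem
        exact hn' hmem
      have hlos := loser_rauzyStep hchange
      rw [← renorm_succ] at hlos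
      have := loser_mem_columnSupport (T := T) (m := m) (n := n + 1) (α := α) (by omega)
        (by rwa [hconst (n + 1) (by omega) (by omega)])
      rw [hconst (n + 1 + 1) (by omega) (by omega), hlos] at this
      exact hn' this
  exact hstay j (by omega) le_rfl (hj ▸ hγ)

theorem min_le_card_columnSupport (hd : 2 ≤ d) (h : T.Regular) (k s : ℕ) (α : 𝒜) :
    min (s + 1) d ≤ (T.columnSupport (T.mmyTime k) α (T.mmyTime (k + 4 * s))).card := by
  induction s with
  | zero =>
    have : α ∈ T.columnSupport (T.mmyTime k) α (T.mmyTime (k + 4 * 0)) := by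
      rw [mem_columnSupport]
      simp [cocycle_self]
    have := Finset.card_pos.mpr ⟨α, this⟩
    omega
  | succ s ih =>
    have hkm : T.mmyTime k ≤ T.mmyTime (k + 4 * s) :=
      (mmyTime_strictMono hd h).monotone (by omega)
    by_cases hu : T.columnSupport (T.mmyTime k) α (T.mmyTime (k + 4 * s)) = Finset.univ
    · have hsub := Finset.card_le_card (columnSupport_mono (T := T) hkm
        ((mmyTime_strictMono hd h).monotone (show k + 4 * s ≤ k + 4 * (s + 1) by omega)) α)
      have hcard : Fintype.card 𝒜 = d := by rw [Fintype.card_congr T.top, Fintype.card_fin]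
      rw [hu, Finset.card_univ, hcard] at hsub
      omega
    · have hlt := Finset.card_lt_card (columnSupport_ssubset hd h hkm
        (Finset.card_pos.mp (by omega)) hu)
      rw [show k + 4 * s + 4 = k + 4 * (s + 1) by ring] at hlt
      omega

theorem mmyCocycle_pos (hd : 2 ≤ d) (h : T.Regular) (k : ℕ) (β α : 𝒜) :
    0 < T.mmyCocycle k (k + 4 * d) β α := by
  have hle := min_le_card_columnSupport hd h k d α
  have hcard : Fintype.card 𝒜 = d := by rw [Fintype.card_congr T.top, Fintype.card_fin]
  have huniv := Finset.card_eq_iff_eq_univ (T.columnSupport (T.mmyTime k) α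
    (T.mmyTime (k + 4 * d))) |>.mp (le_antisymm (Finset.card_le_univ _) (by omega))
  exact mem_columnSupport.mp (huniv ▸ Finset.mem_univ β)

end Recurrence

/-! ### Discontinuities are singularities -/

section Continuity

variable {𝒜 : Type*} [Fintype 𝒜] {d : ℕ} {T : IntervalExchange 𝒜 d}

theorem continuousWithinAt_map (hlen : ∀ α, 0 < T.len α) {x : ℝ} (hx : x ∈ T.domain)
    (hne : ∀ α, 0 < (T.top α : ℕ) → x ≠ T.p α) : ContinuousWithinAt T.map T.domain x := by
  obtain ⟨α, hα⟩ := exists_mem_subinterval hx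
  have hmem : T.subinterval α ∈ 𝓝[T.domain] x := by
    -- The first subinterval starts at 0, the end of the domain, where continuity is only one-sided.
    rcases Nat.eq_zero_or_pos (T.top α) with h0 | h0
    · have hp : T.p α = 0 := rowStart_first T.top T.len h0
      filter_upwards [self_mem_nhdsWithin, mem_nhdsWithin_of_mem_nhds (Iio_mem_nhds hα.2)]
        with y hy hy' using ⟨hp ▸ hy.1, hy'⟩
    · have hlt : T.p α < x := lt_of_le_of_ne hα.1 (hne α h0).symm
      exact mem_nhdsWithin_of_mem_nhds
        (mem_of_superset (Ioo_mem_nhds hlt hα.2) Set.Ioo_subset_Ico_self)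
  have hc : ContinuousWithinAt (fun y => y + (T.q α - T.p α)) T.domain x := by fun_prop
  exact hc.congr_of_eventuallyEq
    (by filter_upwards [hmem] with y hy using map_eq hlen hy) (map_eq hlen hα)

theorem discontinuities_subset_singularities (hlen : ∀ α, 0 < T.len α) (n : ℕ) :
    T.discontinuities n ⊆ T.singularities n := by
  rintro x ⟨hx, hdisc⟩
  refine ⟨hx, ?_⟩
  by_contra hcon
  push Not at hcon
  refine hdisc ?_
  clear hdisc
  induction n with
  | zero => exact continuousWithinAt_id
  | succ n ih =>
    rw [Function.iterate_succ']
    exact (continuousWithinAt_map hlen ((mapsTo_map hlen).iterate n hx)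
      fun α hα => hcon n (Nat.lt_succ_self n) α hα).comp
      (ih fun i hi => hcon i (by omega)) ((mapsTo_map hlen).iterate n)

end Continuity

/-! ### The minimal distance between singularities -/

section MinDist

variable {𝒜 : Type*} [Fintype 𝒜] [DecidableEq 𝒜] {d : ℕ} [NeZero d]
  {T : IntervalExchange 𝒜 d}

theorem exists_top_eq_zero (T : IntervalExchange 𝒜 d) : ∃ α, (T.top α : ℕ) = 0 :=
  ⟨T.top.symm 0, by simp⟩

theorem nontrivial_union_endpoints (hlen : ∀ α, 0 < T.len α) (S : Set ℝ) :
    (S ∪ {0, T.total}).Nontrivial :=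
  ⟨0, by simp, T.total, by simp, (total_pos hlen).ne⟩

theorem minDist_anti (hlen : ∀ α, 0 < T.len α) {S S' : Set ℝ} (h : S ⊆ S') :
    T.minDist S' ≤ T.minDist S :=
  (nontrivial_union_endpoints hlen S).infsep_anti (Set.union_subset_union_left _ h)

theorem le_minDist_of_subset_towerEnds {S : IntervalExchange 𝒜 d} {r : 𝒜 → ℕ}
    (h : IsTower T S r) (hr : ∀ α, 0 < r α) (hT : ∀ α, 0 < T.len α) (hS : ∀ α, 0 < S.len α)
    {c : ℝ} (hc : ∀ α, c ≤ S.len α) {E : Set ℝ} (hE : E ⊆ towerEnds T S r) :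
    c ≤ T.minDist E := by
  have h0 : (0 : ℝ) ∈ towerEnds T S r := by
    obtain ⟨α, hα⟩ := S.exists_top_eq_zero
    exact ⟨α, 0, hr α, rowStart_first S.top S.len hα⟩
  have hmem : ∀ x ∈ E ∪ {0, T.total}, x ∈ towerEnds T S r ∨ x = T.total := by
    rintro x (hx | rfl | rfl)
    · exact Or.inl (hE hx)
    · exact Or.inl h0
    · exact Or.inr rfl
  have hlt : ∀ x ∈ E ∪ {0, T.total}, ∀ y ∈ E ∪ {0, T.total}, x < y → c ≤ y - x := by
    intro x hx y hy hxy
    rcases hmem x hx with hx | rfl <;> rcases hmem y hy with hy | rfl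
    · exact h.le_sub_of_lt hT hS hc hx hy hxy
    · exact h.le_total_sub hT hS hc hx
    · linarith [h.le_total_sub hT hS hc hy]
    · exact absurd hxy (lt_irrefl _)
  refine (nontrivial_union_endpoints hT E).le_infsep fun x hx y hy hxy => ?_
  rw [Real.dist_eq]
  rcases hxy.lt_or_gt with hxy | hxy
  · rw [abs_sub_comm]
    exact (hlt x hx y hy hxy).trans (le_abs_self _)
  · exact (hlt y hy x hx hxy).trans (le_abs_self _)

theorem singularities_subset_towerEnds {S S' : IntervalExchange 𝒜 d} {r r' : 𝒜 → ℕ}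
    (hT : T.Regular) (h : IsTower T S r) (h' : IsTower T S' r')
    (hS : ∀ α, 0 < S.len α) (hS' : ∀ α, 0 < S'.len α) {n : ℕ} (hn : ∀ α, n ≤ r α)
    (hlen : ∀ α, S'.total ≤ S.len α) : T.singularities n ⊆ towerEnds T S' r' := by
  rintro y ⟨hy, i, hi, β, hβ, hiy⟩
  obtain ⟨α, z, hz, j, hj, rfl⟩ := h'.cover y hy
  rw [← Function.iterate_add_apply] at hiy
  rcases lt_or_ge (i + j) (r' α) with hlt | hge
  · exact ⟨α, j, hj, by rw [h'.eq_p hT.len_pos hS' hz hlt hiy]⟩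
  exfalso
  -- The orbit returns to the domain of `S'` before hitting `p β`; `k` is the time left after that
  -- return. It is less than `i`, hence less than every height over `S`.
  obtain ⟨k, hk⟩ := Nat.exists_eq_add_of_le' hge
  rw [hk, Function.iterate_add_apply, h'.iterate_eq α z hz] at hiy
  have hz' := mapsTo_map hS' (subinterval_subset_domain hS' α hz)
  obtain ⟨φ, hφ⟩ := S.exists_top_eq_zero
  have hφlen : S.p φ + S.len φ ≤ S.total := rowStart_add_len_le_sum S.top hS φ
  have hpφ : S.p φ = 0 := rowStart_first S.top S.len hφ
  obtain ⟨γ, hγ⟩ := exists_mem_subinterval (T := S) (x := S'.map z)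
    ⟨hz'.1, hz'.2.trans_le (by linarith [hlen φ])⟩
  have hp := h.eq_p hT.len_pos hS hγ (lt_of_lt_of_le (by omega) (hn γ)) hiy
  -- The returned point is now a left end for `S`. If it is 0, the orbit of 0 reaches `p β`, against
  -- the Keane property; any other left end of `S` lies beyond the domain of `S'`.
  rcases Nat.eq_zero_or_pos (S.top γ) with h0 | h0
  · have hp0 : S.p γ = 0 := rowStart_first S.top S.len h0
    obtain ⟨ψ, hψ⟩ := T.exists_top_eq_zero
    have hpψ : T.p ψ = 0 := rowStart_first T.top T.len hψ
    rw [hp, hp0, ← hpψ] at hiy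
    rcases Nat.eq_zero_or_pos k with rfl | hk0
    · rw [← p_injective hT.len_pos hiy] at hβ
      omega
    · exact hT.keane ⟨ψ, β, k, hk0, hβ, hiy⟩
  · have hle : S.p φ + S.len φ ≤ S.p γ := rowStart_add_len_le S.top hS (by
      rw [Fin.lt_def]
      omega)
    rw [hp] at hz'
    linarith [hz'.2, hlen φ]

end MinDist

/-! ### Growth of the accelerated cocycle -/

section Growth

variable {𝒜 : Type*} [Fintype 𝒜] [DecidableEq 𝒜] {d : ℕ} [NeZero d]
  {T : IntervalExchange 𝒜 d}

theorem entryNorm_nonneg (B : Matrix 𝒜 𝒜 ℤ) : 0 ≤ entryNorm B :=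
  Finset.sum_nonneg fun _ _ => Finset.sum_nonneg fun _ _ => abs_nonneg _

theorem entryNorm_mul_le (A B : Matrix 𝒜 𝒜 ℤ) : entryNorm (A * B) ≤ entryNorm A * entryNorm B := by
  have hrow : ∀ γ, ∑ β, |(B γ β : ℝ)| ≤ entryNorm B := fun γ =>
    Finset.single_le_sum (f := fun γ => ∑ β, |(B γ β : ℝ)|)
      (fun _ _ => Finset.sum_nonneg fun _ _ => abs_nonneg _) (Finset.mem_univ γ)
  calc entryNorm (A * B) ≤ ∑ α, ∑ β, ∑ γ, |(A α γ : ℝ)| * |(B γ β : ℝ)| := by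
        refine Finset.sum_le_sum fun α _ => Finset.sum_le_sum fun β _ => ?_
        rw [Matrix.mul_apply, Int.cast_sum]
        refine (Finset.abs_sum_le_sum_abs _ _).trans_eq ?_
        simp only [Int.cast_mul, abs_mul]
    _ = ∑ α, ∑ γ, |(A α γ : ℝ)| * ∑ β, |(B γ β : ℝ)| := by
        refine Finset.sum_congr rfl fun α _ => ?_
        rw [Finset.sum_comm]
        simp only [Finset.mul_sum]
    _ ≤ ∑ α, ∑ γ, |(A α γ : ℝ)| * entryNorm B :=
        Finset.sum_le_sum fun α _ => Finset.sum_le_sum fun γ _ =>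
          mul_le_mul_of_nonneg_left (hrow γ) (abs_nonneg _)
    _ = entryNorm A * entryNorm B := by
        simp only [entryNorm, ← Finset.sum_mul]

theorem returnTime_pos (T : IntervalExchange 𝒜 d) (n : ℕ) (α : 𝒜) : 0 < T.returnTime n α := by
  induction n generalizing α with
  | zero => exact one_pos
  | succ n ih =>
    rw [returnTime]
    by_cases h : α = (T.renorm n).loser
    · rw [h, Function.update_self]
      exact Nat.add_pos_left (ih _) _
    · rw [Function.update_of_ne h]
      exact ih α

theorem entryNorm_mmyCocycle_zero (T : IntervalExchange 𝒜 d) (k : ℕ) :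
    entryNorm (T.mmyCocycle 0 k) = ∑ α, (T.returnTime (T.mmyTime k) α : ℝ) := by
  refine Finset.sum_congr rfl fun α _ => ?_
  rw [← Int.cast_natCast, returnTime_eq, Int.cast_sum]
  refine Finset.sum_congr rfl fun β _ => abs_of_nonneg ?_
  exact_mod_cast T.cocycle_nonneg (Nat.zero_le _) α β

theorem returnTime_le_entryNorm (T : IntervalExchange 𝒜 d) (k : ℕ) (α : 𝒜) :
    (T.returnTime (T.mmyTime k) α : ℝ) ≤ entryNorm (T.mmyCocycle 0 k) := by
  rw [entryNorm_mmyCocycle_zero]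
  exact Finset.single_le_sum (f := fun α => (T.returnTime (T.mmyTime k) α : ℝ))
    (fun _ _ => Nat.cast_nonneg _) (Finset.mem_univ α)

theorem one_le_entryNorm (T : IntervalExchange 𝒜 d) (k : ℕ) :
    1 ≤ entryNorm (T.mmyCocycle 0 k) := by
  refine le_trans ?_ (T.returnTime_le_entryNorm k T.lastTop)
  exact_mod_cast T.returnTime_pos _ _

theorem entryNorm_le_returnTime (hd : 2 ≤ d) (h : T.Regular) (k : ℕ) (α : 𝒜) :
    entryNorm (T.mmyCocycle 0 k) ≤ T.returnTime (T.mmyTime (k + 4 * d)) α := by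
  have hk : T.mmyTime k ≤ T.mmyTime (k + 4 * d) :=
    (mmyTime_strictMono hd h).monotone (by omega)
  have key : ∑ β, (T.returnTime (T.mmyTime k) β : ℤ) ≤
      T.returnTime (T.mmyTime (k + 4 * d)) α := by
    simp only [returnTime_eq]
    rw [← T.cocycle_mul (Nat.zero_le _) hk]
    refine Finset.sum_comm.trans_le ?_
    refine Finset.sum_le_sum fun β _ => ?_
    rw [Matrix.mul_apply]
    refine Finset.sum_le_sum fun γ _ => ?_
    have h1 : 0 < T.cocycle (T.mmyTime k) (T.mmyTime (k + 4 * d)) α γ := mmyCocycle_pos hd h k α γ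
    exact le_mul_of_one_le_left (T.cocycle_nonneg (Nat.zero_le _) _ _) h1
  rw [entryNorm_mmyCocycle_zero]
  exact_mod_cast key

theorem total_le_len (hd : 2 ≤ d) (h : T.Regular) (k : ℕ) (α : 𝒜) :
    (T.renorm (T.mmyTime (k + 4 * d))).total ≤ (T.renorm (T.mmyTime k)).len α := by
  rw [h.len_renorm hd ((mmyTime_strictMono hd h).monotone (show k ≤ k + 4 * d by omega)) α]
  refine Finset.sum_le_sum fun β _ => ?_
  refine le_mul_of_one_le_right ((h.renorm hd _).len_pos β).le ?_
  have h1 : 0 < T.cocycle (T.mmyTime k) (T.mmyTime (k + 4 * d)) β α := mmyCocycle_pos hd h k β α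
  exact_mod_cast h1

theorem total_le_total_mul_entryNorm (hd : 2 ≤ d) (h : T.Regular) (k : ℕ) :
    T.total ≤ (T.renorm (T.mmyTime k)).total * entryNorm (T.mmyCocycle 0 k) := by
  rw [h.sum_len_mul_returnTime hd (T.mmyTime k), total, Finset.sum_mul]
  exact Finset.sum_le_sum fun β _ => mul_le_mul_of_nonneg_left (T.returnTime_le_entryNorm k β)
    ((h.renorm hd _).len_pos β).le

theorem exists_le_entryNorm (hd : 2 ≤ d) (h : T.Regular) (n : ℕ) :
    ∃ k, (n : ℝ) ≤ entryNorm (T.mmyCocycle 0 k) := by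
  induction n with
  | zero => exact ⟨0, by simpa using entryNorm_nonneg _⟩
  | succ n ih =>
    obtain ⟨k, hk⟩ := ih
    refine ⟨k + 4 * d, ?_⟩
    have hne : T.lastTop ≠ T.lastBot := h.admissible.lastTop_ne_lastBot hd
    have hsum : ∑ α ∈ {T.lastTop, T.lastBot}, (T.returnTime (T.mmyTime (k + 4 * d)) α : ℝ) ≤
        entryNorm (T.mmyCocycle 0 (k + 4 * d)) := by
      rw [entryNorm_mmyCocycle_zero]
      exact Finset.sum_le_sum_of_subset_of_nonneg (Finset.subset_univ _)
        fun _ _ _ => Nat.cast_nonneg _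
    rw [Finset.sum_pair hne] at hsum
    push_cast
    -- Two distinct letters each contribute the old norm, so the norm at least doubles.
    linarith [entryNorm_le_returnTime hd h k T.lastTop, entryNorm_le_returnTime hd h k T.lastBot,
      T.one_le_entryNorm k]

/-- The shift 12d is spent in three equal parts: to make the heights at least n, to fit the domain
into the first subinterval, and to bound the shortest subinterval from below. -/
theorem total_le_minDist (hd : 2 ≤ d) (h : T.Regular) {n k : ℕ}
    (hn : (n : ℝ) ≤ entryNorm (T.mmyCocycle 0 k)) :
    (T.renorm (T.mmyTime (k + 12 * d))).total ≤ T.minDist (T.singularities n) := by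
  have hlen := fun m => (h.renorm hd m).len_pos
  have hk : k + 12 * d = k + 4 * d + 4 * d + 4 * d := by ring
  rw [hk]
  refine le_minDist_of_subset_towerEnds (h.isTower hd (T.mmyTime (k + 4 * d + 4 * d)))
    (T.returnTime_pos _) h.len_pos (hlen _) (total_le_len hd h _) ?_
  refine singularities_subset_towerEnds h (h.isTower hd (T.mmyTime (k + 4 * d)))
    (h.isTower hd _) (hlen _) (hlen _) (fun α => ?_) (total_le_len hd h _)
  exact_mod_cast hn.trans (entryNorm_le_returnTime hd h k α)

/-! ### From Condition (A) to Condition (D) -/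

theorem ConditionA.entryNorm_succ_le (hd : 2 ≤ d) (h : T.Regular) (hA : T.ConditionA) {ε : ℝ}
    (hε : 0 < ε) : ∃ C : ℝ, 0 < C ∧ ∀ k, entryNorm (T.mmyCocycle 0 (k + 1)) ≤
      C * entryNorm (T.mmyCocycle 0 k) ^ (1 + ε) := by
  obtain ⟨C, hC, hCk⟩ := hA ε hε
  -- Condition (A) starts at k = 1; the second entry of the maximum covers k = 0.
  refine ⟨max C (entryNorm (T.mmyCocycle 0 1)), lt_max_of_lt_left hC, fun k => ?_⟩
  have h1 := T.one_le_entryNorm k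
  have h0 : 0 < entryNorm (T.mmyCocycle 0 k) := one_pos.trans_le h1
  rcases Nat.eq_zero_or_pos k with rfl | hk
  · refine (le_max_right C _).trans (le_mul_of_one_le_right ?_ ?_)
    · exact hC.le.trans (le_max_left _ _)
    · exact Real.one_le_rpow h1 (by linarith)
  · have hmul : T.mmyCocycle 0 (k + 1) = T.mmyCocycle k (k + 1) * T.mmyCocycle 0 k :=
      (T.cocycle_mul (Nat.zero_le _) (mmyTime_strictMono hd h (Nat.lt_succ_self k)).le).symm
    rw [hmul]
    calc _ ≤ entryNorm (T.mmyCocycle k (k + 1)) * entryNorm (T.mmyCocycle 0 k) :=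
          entryNorm_mul_le _ _
      _ ≤ max C (entryNorm (T.mmyCocycle 0 1)) * entryNorm (T.mmyCocycle 0 k) ^ ε *
          entryNorm (T.mmyCocycle 0 k) :=
          mul_le_mul_of_nonneg_right ((hCk k hk).trans (mul_le_mul_of_nonneg_right
            (le_max_left _ _) (Real.rpow_nonneg h0.le _))) h0.le
      _ = _ := by
          rw [Real.rpow_add h0, Real.rpow_one]
          ring

theorem ConditionA.entryNorm_add_le (hd : 2 ≤ d) (h : T.Regular) (hA : T.ConditionA) (s : ℕ)
    {ε : ℝ} (hε : 0 < ε) : ∃ C : ℝ, 0 < C ∧ ∀ k, entryNorm (T.mmyCocycle 0 (k + s)) ≤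
      C * entryNorm (T.mmyCocycle 0 k) ^ (1 + ε) := by
  induction s generalizing ε with
  | zero =>
    refine ⟨1, one_pos, fun k => ?_⟩
    rw [one_mul]
    exact Real.self_le_rpow_of_one_le (T.one_le_entryNorm k) (by linarith)
  | succ s ih =>
    obtain ⟨δ, hδ, hδε⟩ : ∃ δ : ℝ, 0 < δ ∧ (1 + δ) * (1 + δ) ≤ 1 + ε := by
      -- With μ = min ε 1 and δ = μ/3, one has 2δ + δ² ≤ 7μ/9 ≤ ε.
      refine ⟨min ε 1 / 3, by positivity, ?_⟩
      have h1 := min_le_left ε 1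
      have h2 := min_le_right ε 1
      have h3 : 0 < min ε 1 := lt_min hε one_pos
      nlinarith
    obtain ⟨C, hC, hCk⟩ := ih hδ
    obtain ⟨C', hC', hCk'⟩ := hA.entryNorm_succ_le hd h hδ
    refine ⟨C' * C ^ (1 + δ), by positivity, fun k => ?_⟩
    have h1 := T.one_le_entryNorm k
    have h0 : 0 ≤ entryNorm (T.mmyCocycle 0 k) := entryNorm_nonneg _
    calc entryNorm (T.mmyCocycle 0 (k + s + 1))
        ≤ C' * entryNorm (T.mmyCocycle 0 (k + s)) ^ (1 + δ) := hCk' (k + s)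
      _ ≤ C' * (C * entryNorm (T.mmyCocycle 0 k) ^ (1 + δ)) ^ (1 + δ) :=
          mul_le_mul_of_nonneg_left
            (Real.rpow_le_rpow (entryNorm_nonneg _) (hCk k) (by linarith)) hC'.le
      _ = C' * C ^ (1 + δ) * entryNorm (T.mmyCocycle 0 k) ^ ((1 + δ) * (1 + δ)) := by
          rw [Real.mul_rpow hC.le (Real.rpow_nonneg h0 _), ← Real.rpow_mul h0, mul_assoc]
      _ ≤ C' * C ^ (1 + δ) * entryNorm (T.mmyCocycle 0 k) ^ (1 + ε) :=
          mul_le_mul_of_nonneg_left (Real.rpow_le_rpow_of_exponent_le h1 hδε) (by positivity)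

theorem ConditionA.singularConditionD (hd : 2 ≤ d) (h : T.Regular) (hA : T.ConditionA) :
    T.SingularConditionD := by
  intro ε hε
  obtain ⟨C, hC, hCk⟩ := hA.entryNorm_add_le hd h (12 * d + 1) hε
  have htot := total_pos h.len_pos
  have hN := fun k => one_pos.trans_le (T.one_le_entryNorm k)
  -- The first entry serves the n whose least index is 0; the second serves all others, where
  -- Condition (A) is applied from the preceding index, hence the shift 12d + 1.
  refine ⟨min (T.total / entryNorm (T.mmyCocycle 0 (12 * d))) (T.total / C),
    lt_min (div_pos htot (hN _)) (div_pos htot hC), fun n hn => ?_⟩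
  have hn1 : (1 : ℝ) ≤ n := by exact_mod_cast hn
  have hnpow : 1 ≤ (n : ℝ) ^ (1 + ε) := Real.one_le_rpow hn1 (by linarith)
  classical
  have hex := exists_le_entryNorm hd h n
  have hmin := total_le_minDist hd h (Nat.find_spec hex)
  have hlow : ∀ k, T.total / entryNorm (T.mmyCocycle 0 k) ≤ (T.renorm (T.mmyTime k)).total :=
    fun k => (div_le_iff₀ (hN k)).mpr (total_le_total_mul_entryNorm hd h k)
  refine le_trans ?_ ((hlow _).trans hmin)
  rcases Nat.eq_zero_or_pos (Nat.find hex) with hk | hk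
  · rw [hk, zero_add]
    refine (div_le_self (le_min ?_ ?_) hnpow).trans (min_le_left _ _)
    · exact (div_pos htot (hN _)).le
    · exact (div_pos htot hC).le
  · obtain ⟨k, hk'⟩ := Nat.exists_eq_add_of_lt hk
    rw [zero_add] at hk'
    have hlt := not_le.mp (Nat.find_min hex (m := k) (by omega))
    rw [hk', show k + 1 + 12 * d = k + (12 * d + 1) by ring]
    have hle : entryNorm (T.mmyCocycle 0 (k + (12 * d + 1))) ≤ C * (n : ℝ) ^ (1 + ε) :=
      (hCk k).trans (mul_le_mul_of_nonneg_left
        (Real.rpow_le_rpow (hN k).le hlt.le (by linarith)) hC.le)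
    calc min (T.total / entryNorm (T.mmyCocycle 0 (12 * d))) (T.total / C) / (n : ℝ) ^ (1 + ε)
        ≤ T.total / C / (n : ℝ) ^ (1 + ε) :=
          div_le_div_of_nonneg_right (min_le_right _ _) (by linarith)
      _ = T.total / (C * (n : ℝ) ^ (1 + ε)) := div_div _ _ _
      _ ≤ T.total / entryNorm (T.mmyCocycle 0 (k + (12 * d + 1))) :=
          div_le_div_of_nonneg_left htot.le (hN _) hle

theorem SingularConditionD.conditionD (hlen : ∀ α, 0 < T.len α) (h : T.SingularConditionD) :
    T.ConditionD := by
  intro ε hε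
  obtain ⟨C, hC, hCn⟩ := h ε hε
  exact ⟨C, hC, fun n hn => (hCn n hn).trans
    (minDist_anti hlen (discontinuities_subset_singularities hlen n))⟩

end Growth

end IntervalExchange

theorem mainTheorem1 {𝒜 : Type*} [Fintype 𝒜] [DecidableEq 𝒜] {d : ℕ} [NeZero d] (hd : 2 ≤ d)
    (T : IntervalExchange 𝒜 d) (hlen : ∀ α, 0 < T.len α)
    (hadm : T.Admissible) (hkeane : T.Keane) (hA : T.ConditionA) :
    T.ConditionD ∧ T.SingularConditionD := by
  have h := hA.singularConditionD hd ⟨hlen, hadm, hkeane⟩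
  exact ⟨h.conditionD hlen, h⟩
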